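/- Let $(\Omega,\mu)$ be a standard Borel probability space and let $\mathcal U$ be a character on $L^\infty(\Omega,\mu)$ (a nonzero multiplicative linear functional) that is not given by the point mass at an atom, i.e. there is no $\omega\in\Omega$ with $\mu(\{\omega\})>0$ and $\mathcal U(f)=f(\omega)$ for all $f\in L^\infty(\Omega,\mu)$. Let $(M_\omega,\tau_\omega)_{\omega\in\Omega}$ be a measurable field of separable tracial von Neumann algebras: each $M_\omega$ is a von Neumann algebra with faithful normal tracial state $\tau_\omega$, and there are sections $e_1,e_2,\dots$ such that $e_1(\omega)=1$, such that $\{e_n(\omega)\}_n$ is a $\|\cdot\|_{2,\tau_\omega}$-dense subset of the operator-norm unit ball of $M_\omega$ for every $\omega$, and such that $\omega\mapsto\tau_\omega(p(e_1(\omega),\dots,e_n(\omega)))$ is measurable for every $n$ and every noncommutative $*$-polynomial $p$. Let $M=\int_\Omega^\oplus M_\omega\,d\mu(\omega)$ be its direct integral, i.e. the $*$-algebra, modulo almost everywhere equality, of the sections $f$ that are bounded in operator norm and for which $\omega\mapsto\tau_\omega(e_n(\omega)f(\omega))$ is measurable for all $n$. Let $E:M\to L^\infty(\Omega,\mu)$,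 $E[f](\omega)=\tau_\omega(f(\omega))$, be the canonical conditional expectation. Let $$M^{/E,\mathcal U}=M/\{x\in M:\ \mathcal U(E(x^*x))=0\}$$ be the ultrafiber, with its trace $\tau_{E,\mathcal U}(x+I)=\mathcal U(E(x))$. 1. If $M^{/E,\mathcal U}$ has a diffuse summand (there is a nonzero central projection $p$ such that $pM^{/E,\mathcal U}$ has no minimal projection), then the density character of $M^{/E,\mathcal U}$ in the metric of $\|x\|_2=\tau_{E,\mathcal U}(x^*x)^{1/2}$, that is, the least cardinality of a dense subset, equals $2^{\aleph_0}$. 2. Otherwise, $M^{/E,\mathcal U}$ is $*$-isomorphic to a countable (von Neumann algebraic, i.e. $\ell^\infty$-) direct sum of matrix algebras $M_{d_i}(\mathbb C)$, and hence it is separable in the metric of $\|\cdot\|_2$. -/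

import Mathlib

open scoped ComplexOrder ENNReal InnerProductSpace
open MeasureTheory

universe u v

noncomputable section

set_option linter.unusedSectionVars false

/-- A tracial state on a complex `*`-algebra: a linear functional `τ` with `τ 1 = 1`,
`τ (x⋆ x) ≥ 0` and `τ (x y) = τ (y x)`. -/
structure TracialState (A : Type u) [Ring A] [StarRing A] [Algebra ℂ A] extends A →ₗ[ℂ] ℂ where
  map_one' : toFun 1 = 1
  nonneg' : ∀ x, 0 ≤ toFun (star x * x)
  tracial' : ∀ x y, toFun (x * y) = toFun (y * x)

namespace TracialState

section Basic

variable {A : Type u} [Ring A] [StarRing A] [Algebra ℂ A]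

instance : FunLike (TracialState A) A ℂ where
  coe τ := τ.toFun
  coe_injective := by
    rintro ⟨⟨⟨f, _⟩, _⟩, _, _, _⟩ ⟨⟨⟨g, _⟩, _⟩, _, _, _⟩ h
    cases h
    rfl

instance : LinearMapClass (TracialState A) ℂ A ℂ where
  map_add τ := τ.map_add'
  map_smulₛₗ τ := τ.map_smul'

variable (τ : TracialState A)

theorem map_one : τ 1 = 1 := τ.map_one'
theorem nonneg (x : A) : 0 ≤ τ (star x * x) := τ.nonneg' x
theorem tracial (x y : A) : τ (x * y) = τ (y * x) := τ.tracial' x y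

theorem map_star [StarModule ℂ A] (x : A) : τ (star x) = star (τ x) := by
  have h1 := (Complex.nonneg_iff.1 (τ.nonneg (1 + x))).2
  have h2 := (Complex.nonneg_iff.1 (τ.nonneg (1 + Complex.I • x))).2
  have h3 := (Complex.nonneg_iff.1 (τ.nonneg x)).2
  simp only [star_add, star_one, star_smul, add_mul, mul_add, one_mul, mul_one, map_add,
    smul_mul_assoc, mul_smul_comm, map_smul, τ.map_one] at h1 h2
  simp at h1 h2
  apply Complex.ext <;> simp <;> linarith

variable [StarModule ℂ A]

/-- The semi-inner product `⟪x, y⟫ = τ (x⋆ y)`. -/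
abbrev core : PreInnerProductSpace.Core ℂ A where
  inner x y := τ (star x * y)
  conj_inner_symm x y := by
    have := τ.map_star (star y * x)
    rw [star_mul, star_star] at this
    rw [this]; rfl
  re_inner_nonneg x := (Complex.nonneg_iff.1 (τ.nonneg x)).1
  add_left x y z := by simp [add_mul]
  smul_left x y r := by simp

variable (A) in
/-- The algebra `A`, regarded as a (semi)normed space with the `L²`-norm `‖x‖₂ = τ (x⋆ x)^{1/2}`,
that is, with the `L²`-metric of `τ`. -/
def L2 (_τ : TracialState A) : Type u := A

instance : AddCommGroup (L2 A τ) := inferInstanceAs (AddCommGroup A)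
instance : Module ℂ (L2 A τ) := inferInstanceAs (Module ℂ A)

instance : SeminormedAddCommGroup (L2 A τ) :=
  InnerProductSpace.Core.toSeminormedAddCommGroup (𝕜 := ℂ) (F := L2 A τ) (c := τ.core)

/-- The norm `‖x‖₂ = τ (x⋆ x)^{1/2}`. -/
def norm2 (x : A) : ℝ := √(τ (star x * x)).re

theorem norm_L2 (x : A) : ‖(show L2 A τ from x)‖ = τ.norm2 x := rfl

theorem norm2_sq (x : A) : τ.norm2 x ^ 2 = (τ (star x * x)).re :=
  Real.sq_sqrt (Complex.nonneg_iff.1 (τ.nonneg x)).1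

theorem norm2_nonneg (x : A) : 0 ≤ τ.norm2 x := Real.sqrt_nonneg _

theorem norm_apply_star_mul_le (x y : A) : ‖τ (star x * y)‖ ≤ τ.norm2 x * τ.norm2 y :=
  InnerProductSpace.Core.norm_inner_le_norm (𝕜 := ℂ) (c := τ.core) x y

theorem norm2_smul (c : ℂ) (x : A) : τ.norm2 (c • x) = ‖c‖ * τ.norm2 x := by
  have h : star (c • x) * (c • x) = ((‖c‖ ^ 2 : ℝ) : ℂ) • (star x * x) := by
    rw [star_smul, smul_mul_smul_comm, Complex.star_def, ← Complex.normSq_eq_conj_mul_self,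
      Complex.normSq_eq_norm_sq]
  rw [norm2, h, map_smul, smul_eq_mul, Complex.re_ofReal_mul, Real.sqrt_mul (by positivity),
    Real.sqrt_sq (norm_nonneg _), norm2]

theorem norm2_star (x : A) : τ.norm2 (star x) = τ.norm2 x := by
  simp [norm2, τ.tracial x]

theorem norm_apply_mul_le (x y : A) : ‖τ (x * y)‖ ≤ τ.norm2 x * τ.norm2 y := by
  simpa [norm2_star] using τ.norm_apply_star_mul_le (star x) y

theorem apply_eq_zero_iff (x : A) : τ (star x * x) = 0 ↔ τ.norm2 x = 0 := by
  have h := Complex.nonneg_iff.1 (τ.nonneg x)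
  rw [norm2, Real.sqrt_eq_zero h.1, Complex.ext_iff]
  simp [h.2.symm]

theorem apply_mul_eq_zero {x : A} (hx : τ (star x * x) = 0) (y : A) : τ (x * y) = 0 := by
  have := τ.norm_apply_mul_le x y
  rw [(τ.apply_eq_zero_iff x).1 hx, zero_mul] at this
  exact norm_le_zero_iff.1 this

end Basic

section CStar

variable {A : Type u} [CStarAlgebra A] (τ : TracialState A)

theorem norm2_le_norm (x : A) : τ.norm2 x ≤ ‖x‖ := by
  let _ := CStarAlgebra.spectralOrder A
  have := CStarAlgebra.spectralOrderedRing A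
  have h1 : star x * x ≤ algebraMap ℝ A ‖star x * x‖ :=
    (IsSelfAdjoint.star_mul_self x).le_algebraMap_norm_self
  obtain ⟨y, hy⟩ := CStarAlgebra.nonneg_iff_eq_star_mul_self.1 (sub_nonneg.2 h1)
  have h2 := (Complex.nonneg_iff.1 (τ.nonneg y)).1
  rw [← hy, map_sub, Algebra.algebraMap_eq_smul_one, ← Complex.coe_smul, map_smul, τ.map_one,
    CStarRing.norm_star_mul_self] at h2
  simp at h2
  rw [norm2]
  exact Real.sqrt_le_iff.2 ⟨norm_nonneg _, by nlinarith⟩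

theorem norm2_one : τ.norm2 1 = 1 := by simp [norm2, τ.map_one]

theorem norm_apply_le (x : A) : ‖τ x‖ ≤ ‖x‖ := by
  have := τ.norm_apply_mul_le 1 x
  rw [one_mul, norm2_one, one_mul] at this
  exact this.trans (τ.norm2_le_norm x)

end CStar
end TracialState

section Quotient
variable {R : Type u} [Ring R] [StarRing R]

/-- An ideal that is closed under the involution. -/
class IsStarStable (I : Ideal R) : Prop where
  star_mem : ∀ x ∈ I, star x ∈ I

variable (I : Ideal R) [I.IsTwoSided] [IsStarStable I]

/-- The involution of `R ⧸ I`, as a ring homomorphism into the opposite ring. -/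
def starQuotientHom : R ⧸ I →+* (R ⧸ I)ᵐᵒᵖ :=
  Ideal.Quotient.lift I ((Ideal.Quotient.mk I).op.comp (starRingEquiv : R ≃+* Rᵐᵒᵖ).toRingHom) <| by
    intro x hx
    simpa [Ideal.Quotient.eq_zero_iff_mem] using IsStarStable.star_mem x hx

instance : StarRing (R ⧸ I) where
  star x := (starQuotientHom I x).unop
  star_involutive x := by
    obtain ⟨x, rfl⟩ := Ideal.Quotient.mk_surjective x
    simp [starQuotientHom]
  star_mul x y := by simp
  star_add x y := by simp

theorem star_mk (x : R) : star (Ideal.Quotient.mk I x) = Ideal.Quotient.mk I (star x) := rfl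

instance [Algebra ℂ R] [StarModule ℂ R] : StarModule ℂ (R ⧸ I) where
  star_smul c x := by
    obtain ⟨x, rfl⟩ := Ideal.Quotient.mk_surjective x
    change Ideal.Quotient.mk I (star (c • x)) = star c • Ideal.Quotient.mk I (star x)
    rw [star_smul]
    rfl

end Quotient

namespace TracialState
variable {A : Type u} [Ring A] [StarRing A] [Algebra ℂ A] [StarModule ℂ A] (τ : TracialState A)

/-- The ideal `{x | τ (x⋆ x) = 0}`. -/
def nullIdeal : Ideal A where
  carrier := {x | τ (star x * x) = 0}
  zero_mem' := by simp
  add_mem' {x y} hx hy := by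
    rw [Set.mem_ofPred_eq, star_add, τ.tracial, add_mul, map_add, τ.apply_mul_eq_zero hx,
      τ.apply_mul_eq_zero hy, add_zero]
  smul_mem' c x hx := by
    rw [Set.mem_ofPred_eq, smul_eq_mul, τ.tracial, mul_assoc, τ.tracial, mul_assoc,
      τ.apply_mul_eq_zero hx]

theorem mem_nullIdeal {x : A} : x ∈ τ.nullIdeal ↔ τ (star x * x) = 0 := Iff.rfl

instance : τ.nullIdeal.IsTwoSided where
  mul_mem_of_left {x} y hx := by
    rw [mem_nullIdeal, τ.tracial, mul_assoc, τ.apply_mul_eq_zero hx]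

instance : IsStarStable τ.nullIdeal where
  star_mem x hx := by
    rwa [mem_nullIdeal, star_star, τ.tracial]

/-- The tracial state induced by `τ` on `A ⧸ {x | τ (x⋆ x) = 0}`. -/
def quotientState : TracialState (A ⧸ τ.nullIdeal) where
  toLinearMap := (τ.nullIdeal.restrictScalars ℂ).liftQ τ.toLinearMap <| by
    intro x hx
    have h : τ x = 0 := by simpa using τ.apply_mul_eq_zero hx 1
    exact h
  map_one' := τ.map_one
  nonneg' x := by
    obtain ⟨x, rfl⟩ := Ideal.Quotient.mk_surjective x
    exact τ.nonneg x
  tracial' x y := by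
    obtain ⟨x, rfl⟩ := Ideal.Quotient.mk_surjective x
    obtain ⟨y, rfl⟩ := Ideal.Quotient.mk_surjective y
    exact τ.tracial x y

theorem quotientState_mk (x : A) : τ.quotientState (Ideal.Quotient.mk τ.nullIdeal x) = τ x := rfl

theorem quotientState_faithful (x : A ⧸ τ.nullIdeal) (hx : τ.quotientState (star x * x) = 0) :
    x = 0 := by
  obtain ⟨x, rfl⟩ := Ideal.Quotient.mk_surjective x
  exact Ideal.Quotient.eq_zero_iff_mem.2 hx

end TracialState

/-- `(A, τ)` is a tracial von Neumann algebra: `τ` is faithful, `A` is (via a faithful unital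
representation `π`) a von Neumann algebra of operators on a Hilbert space, and `τ` is normal, that
is, of the form `x ↦ ∑ ⟪ξ n, x η n⟫` with `∑ ‖ξ n‖² < ∞` and `∑ ‖η n‖² < ∞` (an ultraweakly
continuous functional, an element of the predual). -/
structure IsTracialVonNeumann {A : Type v} [CStarAlgebra A] (τ : TracialState A) : Prop where
  faithful : ∀ x, τ (star x * x) = 0 → x = 0
  exists_representation : ∃ (H : Type v) (_ : NormedAddCommGroup H) (_ : InnerProductSpace ℂ H)
    (_ : CompleteSpace H) (S : VonNeumannAlgebra H) (π : A →⋆ₐ[ℂ] (H →L[ℂ] H)),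
    Function.Injective π ∧ Set.range π = (S : Set (H →L[ℂ] H)) ∧
    ∃ ξ η : ℕ → H, Summable (fun n => ‖ξ n‖ ^ 2) ∧ Summable (fun n => ‖η n‖ ^ 2) ∧
      ∀ x, HasSum (fun n => ⟪ξ n, π x (η n)⟫_ℂ) (τ x)

/-- Evaluation of a noncommutative `*`-polynomial at the sequence `a`. The free variable `inl n`
stands for `a n` and the free variable `inr n` for its adjoint. -/
def evalStarPoly {A : Type v} [Ring A] [StarRing A] [Algebra ℂ A] (a : ℕ → A) :
    FreeAlgebra ℂ (ℕ ⊕ ℕ) →ₐ[ℂ] A :=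
  FreeAlgebra.lift ℂ (Sum.elim a (fun n => star (a n)))

/-- A measurable field of separable tracial von Neumann algebras over `(Ω, μ)`. Measurability of
complex functions is understood with respect to the completion of `μ`, here and below. The sequence
of sections `e n` starts with the unit, is dense in the unit ball of each fiber with respect to
`‖·‖₂`, and all traces of `*`-polynomials in it are measurable. -/
structure MeasurableField {Ω : Type u} [MeasurableSpace Ω] (μ : Measure Ω) where
  Fiber : Ω → Type v
  [cstar : ∀ ω, CStarAlgebra (Fiber ω)]
  tr : ∀ ω, TracialState (Fiber ω)
  isTracialVonNeumann : ∀ ω, IsTracialVonNeumann (tr ω)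
  e : ℕ → ∀ ω, Fiber ω
  e_zero : ∀ ω, e 0 ω = 1
  norm_e_le : ∀ n ω, ‖e n ω‖ ≤ 1
  dense_e : ∀ ω (x : Fiber ω), ‖x‖ ≤ 1 → ∀ ε > 0, ∃ n, (tr ω).norm2 (x - e n ω) < ε
  aemeasurable_tr : ∀ p : FreeAlgebra ℂ (ℕ ⊕ ℕ),
    AEMeasurable (fun ω => tr ω (evalStarPoly (fun n => e n ω) p)) μ

namespace MeasurableField

attribute [instance] MeasurableField.cstar

variable {Ω : Type u} [MeasurableSpace Ω] {μ : Measure Ω} (M : MeasurableField.{u, v} μ)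

/-- Measurable sections: all the functions `ω ↦ τ_ω (e_n(ω) f(ω))` are measurable. -/
def IsMeasurableSection (f : ∀ ω, M.Fiber ω) : Prop :=
  ∀ n, AEMeasurable (fun ω => M.tr ω (M.e n ω * f ω)) μ

/-- Sections that are bounded in operator norm. -/
def IsBoundedSection (f : ∀ ω, M.Fiber ω) : Prop :=
  ∃ C : ℝ, ∀ ω, ‖f ω‖ ≤ C

/-- The section obtained by evaluating a polynomial. -/
def polySection (p : FreeAlgebra ℂ (ℕ ⊕ ℕ)) (ω : Ω) : M.Fiber ω :=
  evalStarPoly (fun n => M.e n ω) p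

theorem polySection_mul (p q : FreeAlgebra ℂ (ℕ ⊕ ℕ)) (ω : Ω) :
    M.polySection (p * q) ω = M.polySection p ω * M.polySection q ω := map_mul _ _ _

theorem exists_poly_e (n : ℕ) : ∃ p, ∀ ω, M.polySection p ω = M.e n ω :=
  ⟨FreeAlgebra.ι ℂ (Sum.inl n), fun ω => by simp [polySection, evalStarPoly]⟩

theorem exists_poly_star (n : ℕ) : ∃ p, ∀ ω, M.polySection p ω = star (M.e n ω) :=
  ⟨FreeAlgebra.ι ℂ (Sum.inr n), fun ω => by simp [polySection, evalStarPoly]⟩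

theorem exists_poly_starSection (p : FreeAlgebra ℂ (ℕ ⊕ ℕ)) :
    ∃ q, ∀ ω, M.polySection q ω = star (M.polySection p ω) := by
  induction p using FreeAlgebra.induction with
  | grade0 r =>
    exact ⟨algebraMap _ _ (star r), fun ω => by simp [polySection, Algebra.algebraMap_eq_smul_one]⟩
  | grade1 x =>
    rcases x with n | n
    · obtain ⟨q, hq⟩ := M.exists_poly_star n
      exact ⟨q, fun ω => by rw [hq]; simp [polySection, evalStarPoly]⟩
    · obtain ⟨q, hq⟩ := M.exists_poly_e n
      exact ⟨q, fun ω => by rw [hq]; simp [polySection, evalStarPoly]⟩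
  | mul a b ha hb =>
    obtain ⟨q, hq⟩ := ha
    obtain ⟨r, hr⟩ := hb
    exact ⟨r * q, fun ω => by simp [polySection_mul, hq, hr]⟩
  | add a b ha hb =>
    obtain ⟨q, hq⟩ := ha
    obtain ⟨r, hr⟩ := hb
    refine ⟨q + r, fun ω => ?_⟩
    have := hq ω
    have := hr ω
    simp_all [polySection]

theorem exists_norm_polySection_le (p : FreeAlgebra ℂ (ℕ ⊕ ℕ)) :
    ∃ C : ℝ, 0 < C ∧ ∀ ω, ‖M.polySection p ω‖ ≤ C := by
  induction p using FreeAlgebra.induction with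
  | grade0 r =>
    refine ⟨‖r‖ + 1, by positivity, fun ω => ?_⟩
    have h : ‖(1 : M.Fiber ω)‖ ≤ 1 := by
      have := M.norm_e_le 0 ω
      rwa [M.e_zero] at this
    have h2 : M.polySection (algebraMap _ _ r) ω = r • 1 := by
      simp [polySection, Algebra.algebraMap_eq_smul_one]
    rw [h2, norm_smul]
    nlinarith [norm_nonneg r]
  | grade1 x =>
    refine ⟨1, one_pos, fun ω => ?_⟩
    rcases x with n | n <;> simpa [polySection, evalStarPoly] using M.norm_e_le n ω
  | mul a b ha hb =>
    obtain ⟨C, hC, h⟩ := ha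
    obtain ⟨D, hD, h'⟩ := hb
    refine ⟨C * D, by positivity, fun ω => ?_⟩
    rw [polySection_mul]
    exact (norm_mul_le _ _).trans (mul_le_mul (h ω) (h' ω) (norm_nonneg _) hC.le)
  | add a b ha hb =>
    obtain ⟨C, hC, h⟩ := ha
    obtain ⟨D, hD, h'⟩ := hb
    refine ⟨C + D, by positivity, fun ω => ?_⟩
    have : M.polySection (a + b) ω = M.polySection a ω + M.polySection b ω := map_add _ _ _
    rw [this]
    exact (norm_add_le _ _).trans (add_le_add (h ω) (h' ω))

theorem aemeasurable_tr_poly (p : FreeAlgebra ℂ (ℕ ⊕ ℕ)) :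
    AEMeasurable (fun ω => M.tr ω (M.polySection p ω)) μ := M.aemeasurable_tr p

theorem aemeasurable_select {F : ℕ → Ω → ℂ} (hF : ∀ n, AEMeasurable (F n) μ) {m : Ω → ℕ}
    (hm : ∀ n, NullMeasurableSet {ω | m ω = n} μ) : AEMeasurable (fun ω => F (m ω) ω) μ := by
  have h : AEMeasurable (fun ω => F (m ω) ω) (μ.restrict (⋃ n, {ω | m ω = n})) := by
    refine aemeasurable_iUnion_iff.2 fun n => ?_
    refine (hF n).restrict.congr ?_
    refine (ae_restrict_iff'₀ (hm n)).2 (.of_forall fun ω hω => ?_)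
    have : m ω = n := hω
    simp [this]
  have h2 : (⋃ n, {ω | m ω = n}) = Set.univ := by ext; simp
  rwa [h2, Measure.restrict_univ] at h

theorem exists_norm2_sub_lt {C : ℝ} (hC : 0 < C) (ω : Ω) {x : M.Fiber ω} (hx : ‖x‖ ≤ C) {ε : ℝ}
    (hε : 0 < ε) : ∃ n, (M.tr ω).norm2 (x - (C : ℂ) • M.e n ω) < ε := by
  obtain ⟨n, hn⟩ := M.dense_e ω ((C : ℂ)⁻¹ • x) (by
    rw [norm_smul, norm_inv, Complex.norm_real, Real.norm_of_nonneg hC.le, inv_mul_le_iff₀ hC]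
    simpa using hx) (ε / C) (by positivity)
  refine ⟨n, ?_⟩
  have h : x - (C : ℂ) • M.e n ω = (C : ℂ) • ((C : ℂ)⁻¹ • x - M.e n ω) := by
    rw [smul_sub, smul_smul, mul_inv_cancel₀ (by exact_mod_cast hC.ne'), one_smul]
  rw [h, TracialState.norm2_smul, Complex.norm_real, Real.norm_of_nonneg hC.le]
  rwa [lt_div_iff₀' hC] at hn

/-- Main approximation lemma: if the `2`-distances from a bounded section `g` to the sections `e n`
(suitably rescaled) are measurable, then `τ (g f)` inherits measurability from the `τ (e n f)`. -/
theorem aemeasurable_of_dist {g f₁ f₂ : ∀ ω, M.Fiber ω} {C : ℝ} (hC : 0 < C)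
    (hg : ∀ ω, ‖g ω‖ ≤ C)
    (hd : ∀ n, AEMeasurable (fun ω => (M.tr ω).norm2 (g ω - (C : ℂ) • M.e n ω)) μ)
    (hf : ∀ n, AEMeasurable (fun ω => M.tr ω (f₁ ω * M.e n ω * f₂ ω)) μ) :
    AEMeasurable (fun ω => M.tr ω (f₁ ω * g ω * f₂ ω)) μ := by
  have hex : ∀ (k : ℕ) ω, ∃ n, (M.tr ω).norm2 (g ω - (C : ℂ) • M.e n ω) < 1 / ((k : ℝ) + 1) :=
    fun k ω => M.exists_norm2_sub_lt hC ω (hg ω) (by positivity)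
  classical
  let m : ℕ → Ω → ℕ := fun k ω => Nat.find (hex k ω)
  have hm : ∀ k n, NullMeasurableSet {ω | m k ω = n} μ := by
    intro k n
    have hlt : ∀ n, NullMeasurableSet
        {ω | (M.tr ω).norm2 (g ω - (C : ℂ) • M.e n ω) < 1 / ((k : ℝ) + 1)} μ :=
      fun n => nullMeasurableSet_lt (hd n) aemeasurable_const
    have : {ω | m k ω = n} =
        {ω | (M.tr ω).norm2 (g ω - (C : ℂ) • M.e n ω) < 1 / ((k : ℝ) + 1)} ∩
        ⋂ j : Fin n, {ω | (M.tr ω).norm2 (g ω - (C : ℂ) • M.e j ω) < 1 / ((k : ℝ) + 1)}ᶜ := by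
      ext ω
      simp only [m, Set.mem_ofPred_eq, Nat.find_eq_iff, Set.mem_inter_iff, Set.mem_iInter,
        Set.mem_compl_iff]
      exact and_congr_right fun _ => ⟨fun h j => h j j.2, fun h j hj => h ⟨j, hj⟩⟩
    rw [this]
    exact (hlt n).inter (.iInter fun j => (hlt j).compl)
  refine aemeasurable_of_tendsto_metrizable_ae' (f := fun k ω =>
    (C : ℂ) * M.tr ω (f₁ ω * M.e (m k ω) ω * f₂ ω))
    (fun k => (aemeasurable_select hf (hm k)).const_mul _) (.of_forall fun ω => ?_)
  have hlim : Filter.Tendsto (fun k : ℕ => (1 / ((k : ℝ) + 1)) * (M.tr ω).norm2 (f₂ ω * f₁ ω))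
      Filter.atTop (nhds 0) := by
    simpa using tendsto_one_div_add_atTop_nhds_zero_nat.mul_const ((M.tr ω).norm2 (f₂ ω * f₁ ω))
  rw [tendsto_iff_norm_sub_tendsto_zero]
  refine squeeze_zero (fun _ => norm_nonneg _) (fun k => ?_) hlim
  have h1 : (C : ℂ) * M.tr ω (f₁ ω * M.e (m k ω) ω * f₂ ω) - M.tr ω (f₁ ω * g ω * f₂ ω) =
      - M.tr ω ((g ω - (C : ℂ) • M.e (m k ω) ω) * (f₂ ω * f₁ ω)) := by
    rw [mul_assoc (f₁ ω), mul_assoc (f₁ ω), (M.tr ω).tracial (f₁ ω), (M.tr ω).tracial (f₁ ω)]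
    simp only [sub_mul, mul_assoc, map_sub, smul_mul_assoc, map_smul, smul_eq_mul, neg_sub]
  rw [h1, norm_neg]
  refine ((M.tr ω).norm_apply_mul_le _ _).trans ?_
  exact mul_le_mul_of_nonneg_right (Nat.find_spec (hex k ω)).le ((M.tr ω).norm2_nonneg _)

theorem aemeasurable_norm2 {g : ∀ ω, M.Fiber ω}
    (h : AEMeasurable (fun ω => M.tr ω (star (g ω) * g ω)) μ) :
    AEMeasurable (fun ω => (M.tr ω).norm2 (g ω)) μ :=
  (Complex.measurable_re.comp_aemeasurable h).sqrt

theorem aemeasurable_dist {g : ∀ ω, M.Fiber ω} (C : ℝ) (n : ℕ)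
    (h1 : AEMeasurable (fun ω => M.tr ω (star (g ω) * g ω)) μ)
    (h2 : AEMeasurable (fun ω => M.tr ω (star (M.e n ω) * g ω)) μ) :
    AEMeasurable (fun ω => (M.tr ω).norm2 (g ω - (C : ℂ) • M.e n ω)) μ := by
  apply aemeasurable_norm2
  obtain ⟨q, hq⟩ := M.exists_poly_e n
  obtain ⟨r, hr⟩ := M.exists_poly_star n
  have h3 := M.aemeasurable_tr_poly (r * q)
  simp only [polySection_mul, hq, hr] at h3
  have h4 : AEMeasurable (fun ω => M.tr ω (star (g ω) * M.e n ω)) μ := by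
    refine (Complex.continuous_conj.measurable.comp_aemeasurable h2).congr (.of_forall fun ω => ?_)
    change star _ = _
    rw [← (M.tr ω).map_star, star_mul, star_star]
  refine (((h1.sub (h2.const_mul (C : ℂ))).sub (h4.const_mul (C : ℂ))).add
    (h3.const_mul ((C : ℂ) * C))).congr (.of_forall fun ω => ?_)
  simp only [star_sub, star_smul, Complex.star_def, Complex.conj_ofReal, sub_mul, mul_sub, map_sub,
    smul_mul_assoc, mul_smul_comm, map_smul, smul_eq_mul, Pi.add_apply, Pi.sub_apply]
  ring

theorem IsMeasurableSection.poly_mul {f : ∀ ω, M.Fiber ω} (hf : M.IsMeasurableSection f)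
    (p : FreeAlgebra ℂ (ℕ ⊕ ℕ)) : AEMeasurable (fun ω => M.tr ω (M.polySection p ω * f ω)) μ := by
  obtain ⟨C, hC, hp⟩ := M.exists_norm_polySection_le p
  have := M.aemeasurable_of_dist (g := M.polySection p) (f₁ := fun _ => 1) (f₂ := f) hC hp ?_ ?_
  · simpa using this
  · intro n
    obtain ⟨q, hq⟩ := M.exists_poly_star n
    obtain ⟨r, hr⟩ := M.exists_poly_starSection p
    have h1 := M.aemeasurable_tr_poly (r * p)
    have h2 := M.aemeasurable_tr_poly (q * p)
    simp only [polySection_mul, hq, hr] at h1 h2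
    exact M.aemeasurable_dist C n h1 h2
  · intro n
    simpa using hf n

theorem IsMeasurableSection.star_mul_self {f : ∀ ω, M.Fiber ω} (hf : M.IsMeasurableSection f)
    (hb : M.IsBoundedSection f) : AEMeasurable (fun ω => M.tr ω (star (f ω) * f ω)) μ := by
  obtain ⟨C, hC⟩ := hb
  set D : ℝ := max C 1 with hD
  have hD0 : 0 < D := by positivity
  have key : ∀ ω, (M.tr ω (star (f ω) * f ω)).re = ⨆ n,
      (2 * D * (M.tr ω (star (M.e n ω) * f ω)).re
        - D ^ 2 * (M.tr ω (star (M.e n ω) * M.e n ω)).re) := by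
    intro ω
    have hid : ∀ n, (M.tr ω).norm2 (f ω - (D : ℂ) • M.e n ω) ^ 2 =
        (M.tr ω (star (f ω) * f ω)).re - (2 * D * (M.tr ω (star (M.e n ω) * f ω)).re
        - D ^ 2 * (M.tr ω (star (M.e n ω) * M.e n ω)).re) := by
      intro n
      have h := (M.tr ω).map_star (star (f ω) * M.e n ω)
      rw [star_mul, star_star] at h
      rw [TracialState.norm2_sq]
      simp only [star_sub, star_smul, Complex.star_def, Complex.conj_ofReal, sub_mul, mul_sub,
        map_sub, smul_mul_assoc, mul_smul_comm, map_smul, smul_eq_mul, h, Complex.sub_re,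
        Complex.re_ofReal_mul, Complex.conj_re]
      ring
    refine (ciSup_eq_of_forall_le_of_forall_lt_exists_gt (fun n => ?_) (fun w hw => ?_)).symm
    · have := sq_nonneg ((M.tr ω).norm2 (f ω - (D : ℂ) • M.e n ω))
      rw [hid n] at this
      linarith
    · have hδ := sub_pos.2 hw
      obtain ⟨n, hn⟩ := M.exists_norm2_sub_lt hD0 ω ((hC ω).trans (le_max_left _ _))
        (Real.sqrt_pos.2 hδ)
      refine ⟨n, ?_⟩
      have h1 := (Real.lt_sqrt ((M.tr ω).norm2_nonneg _)).1 hn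
      rw [hid n] at h1
      linarith
  have hre : AEMeasurable (fun ω => (M.tr ω (star (f ω) * f ω)).re) μ := by
    simp only [key]
    refine AEMeasurable.iSup fun n => ?_
    obtain ⟨q, hq⟩ := M.exists_poly_e n
    obtain ⟨r, hr⟩ := M.exists_poly_star n
    have h1 := hf.poly_mul M r
    have h2 := M.aemeasurable_tr_poly (r * q)
    simp only [polySection_mul, hq, hr] at h1 h2
    exact ((Complex.measurable_re.comp_aemeasurable h1).const_mul _).sub
      ((Complex.measurable_re.comp_aemeasurable h2).const_mul _)
  refine (Complex.measurable_ofReal.comp_aemeasurable hre).congr (.of_forall fun ω => ?_)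
  exact Complex.ext rfl (Complex.nonneg_iff.1 ((M.tr ω).nonneg (f ω))).2

theorem IsMeasurableSection.mul {f g : ∀ ω, M.Fiber ω} (hf : M.IsMeasurableSection f)
    (hfb : M.IsBoundedSection f) (hg : M.IsMeasurableSection g) :
    M.IsMeasurableSection (fun ω => f ω * g ω) := by
  intro n
  have h1 := hf.star_mul_self M hfb
  obtain ⟨C, hC⟩ := hfb
  have := M.aemeasurable_of_dist (C := max C 1) (g := f) (f₁ := M.e n) (f₂ := g) (by positivity)
    (fun ω => (hC ω).trans (le_max_left _ _)) ?_ ?_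
  · simpa [mul_assoc] using this
  · intro k
    refine M.aemeasurable_dist _ k h1 ?_
    obtain ⟨q, hq⟩ := M.exists_poly_star k
    simpa [hq] using hf.poly_mul M q
  · intro k
    obtain ⟨q, hq⟩ := M.exists_poly_e n
    obtain ⟨r, hr⟩ := M.exists_poly_e k
    simpa [polySection_mul, hq, hr] using hg.poly_mul M (q * r)

theorem IsMeasurableSection.star {f : ∀ ω, M.Fiber ω} (hf : M.IsMeasurableSection f) :
    M.IsMeasurableSection (fun ω => star (f ω)) := by
  intro n
  obtain ⟨q, hq⟩ := M.exists_poly_star n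
  have h := hf.poly_mul M q
  simp only [hq] at h
  refine (Complex.continuous_conj.measurable.comp_aemeasurable h).congr (.of_forall fun ω => ?_)
  change Star.star _ = _
  rw [← (M.tr ω).map_star, star_mul, star_star, (M.tr ω).tracial]

/-- The `*`-algebra of bounded measurable sections, with pointwise operations. -/
def boundedMeasurableSections : StarSubalgebra ℂ (∀ ω, M.Fiber ω) where
  carrier := {f | M.IsMeasurableSection f ∧ M.IsBoundedSection f}
  mul_mem' := by
    rintro f g ⟨hf, hfb⟩ ⟨hg, hgb⟩
    refine ⟨hf.mul M hfb hg, ?_⟩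
    obtain ⟨C, hC⟩ := hfb
    obtain ⟨D, hD⟩ := hgb
    exact ⟨C * D, fun ω => (norm_mul_le _ _).trans
      (mul_le_mul (hC ω) (hD ω) (norm_nonneg _) ((norm_nonneg _).trans (hC ω)))⟩
  add_mem' := by
    rintro f g ⟨hf, C, hC⟩ ⟨hg, D, hD⟩
    refine ⟨fun n => ?_, C + D, fun ω => (norm_add_le _ _).trans (add_le_add (hC ω) (hD ω))⟩
    exact ((hf n).add (hg n)).congr (.of_forall fun ω => by simp [mul_add])
  algebraMap_mem' c := by
    obtain ⟨C, -, hC⟩ := M.exists_norm_polySection_le (algebraMap _ _ c)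
    have h : M.polySection (algebraMap _ _ c) = algebraMap ℂ (∀ ω, M.Fiber ω) c := by
      funext ω
      simp [polySection]
    rw [h] at hC
    refine ⟨fun n => ?_, C, hC⟩
    obtain ⟨q, hq⟩ := M.exists_poly_e n
    have := M.aemeasurable_tr_poly (q * algebraMap _ _ c)
    simpa only [polySection_mul, hq, h] using this
  star_mem' := by
    rintro f ⟨hf, C, hC⟩
    exact ⟨hf.star M, C, fun ω => by simpa using hC ω⟩

/-- The ideal of sections that vanish almost everywhere. -/
def aeZero : Ideal M.boundedMeasurableSections where
  carrier := {f | ∀ᵐ ω ∂μ, f.1 ω = 0}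
  zero_mem' := by
    change ∀ᵐ ω ∂μ, (0 : M.boundedMeasurableSections).1 ω = 0
    exact .of_forall fun _ => rfl
  add_mem' {f g} hf hg := by
    change ∀ᵐ ω ∂μ, (f + g).1 ω = 0
    filter_upwards [hf, hg] with ω h1 h2
    simp [h1, h2]
  smul_mem' f g hg := by
    change ∀ᵐ ω ∂μ, (f * g).1 ω = 0
    filter_upwards [hg] with ω h
    simp [h]

theorem mem_aeZero {f : M.boundedMeasurableSections} : f ∈ M.aeZero ↔ ∀ᵐ ω ∂μ, f.1 ω = 0 := Iff.rfl

instance : M.aeZero.IsTwoSided where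
  mul_mem_of_left {f} g hf := by
    rw [mem_aeZero] at hf ⊢
    filter_upwards [hf] with ω h
    simp [h]

instance : IsStarStable M.aeZero where
  star_mem f hf := by
    rw [mem_aeZero] at hf ⊢
    filter_upwards [hf] with ω h
    simp [h]

/-- The direct integral of the field: bounded measurable sections modulo equality almost
everywhere. -/
def DirectIntegral : Type (max u v) := M.boundedMeasurableSections ⧸ M.aeZero

instance : Ring M.DirectIntegral :=
  inferInstanceAs (Ring (M.boundedMeasurableSections ⧸ M.aeZero))
instance : StarRing M.DirectIntegral :=
  inferInstanceAs (StarRing (M.boundedMeasurableSections ⧸ M.aeZero))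
instance : Algebra ℂ M.DirectIntegral :=
  inferInstanceAs (Algebra ℂ (M.boundedMeasurableSections ⧸ M.aeZero))
instance : StarModule ℂ M.DirectIntegral :=
  inferInstanceAs (StarModule ℂ (M.boundedMeasurableSections ⧸ M.aeZero))

/-- The class of a bounded measurable section in the direct integral. -/
def toDirectIntegral : M.boundedMeasurableSections →⋆ₐ[ℂ] M.DirectIntegral where
  toAlgHom := Ideal.Quotient.mkₐ ℂ M.aeZero
  map_star' _ := rfl

theorem toDirectIntegral_surjective : Function.Surjective M.toDirectIntegral := Ideal.Quotient.mk_surjective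

theorem memLp_tr (f : M.boundedMeasurableSections) :
    MemLp (fun ω => M.tr ω (f.1 ω)) ∞ μ := by
  obtain ⟨f, hf, C, hC⟩ := f
  refine memLp_top_of_bound ?_ C (.of_forall fun ω => ((M.tr ω).norm_apply_le _).trans (hC ω))
  have := hf 0
  simp only [M.e_zero, one_mul] at this
  exact this.aestronglyMeasurable

/-- The canonical conditional expectation `E` of the direct integral onto `L^∞(Ω, μ)`:
`E[f](ω) = τ_ω (f(ω))`. -/
def expectation : M.DirectIntegral →ₗ[ℂ] Lp ℂ ∞ μ :=
  (M.aeZero.restrictScalars ℂ).liftQ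
    { toFun := fun f => (M.memLp_tr f).toLp
      map_add' := fun f g => by
        rw [← MemLp.toLp_add]
        refine MemLp.toLp_congr _ _ (.of_forall fun ω => ?_)
        exact map_add (M.tr ω) _ _
      map_smul' := fun c f => by
        rw [RingHom.id_apply, ← MemLp.toLp_const_smul]
        refine MemLp.toLp_congr _ _ (.of_forall fun ω => ?_)
        exact map_smul (M.tr ω) _ _ } <| by
    intro f hf
    refine (Lp.eq_zero_iff_ae_eq_zero).2 ?_
    filter_upwards [MemLp.coeFn_toLp (M.memLp_tr f), M.mem_aeZero.1 hf] with ω h1 h2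
    exact h1.trans (by simp [h2])

theorem expectation_toDirectIntegral (f : M.boundedMeasurableSections) :
    M.expectation (M.toDirectIntegral f) =ᵐ[μ] fun ω => M.tr ω (f.1 ω) :=
  MemLp.coeFn_toLp (M.memLp_tr f)

end MeasurableField

/-- A character on `L^∞(Ω, μ)`: a nonzero multiplicative linear functional. Here `f • g` is the
product of two elements of `L^∞`. -/
structure LinftyCharacter {Ω : Type u} [MeasurableSpace Ω] (μ : Measure Ω) extends
    Lp ℂ ∞ μ →ₗ[ℂ] ℂ where
  map_mul' : ∀ f g : Lp ℂ ∞ μ, toFun (f • g : Lp ℂ ∞ μ) = toFun f * toFun g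
  exists_ne_zero : ∃ f, toFun f ≠ 0

namespace LinftyCharacter

variable {Ω : Type u} [MeasurableSpace Ω] {μ : Measure Ω}

instance : FunLike (LinftyCharacter μ) (Lp ℂ ∞ μ) ℂ where
  coe U := U.toFun
  coe_injective := by
    rintro ⟨⟨⟨f, _⟩, _⟩, _, _⟩ ⟨⟨⟨g, _⟩, _⟩, _, _⟩ h
    cases h
    rfl

instance : LinearMapClass (LinftyCharacter μ) ℂ (Lp ℂ ∞ μ) ℂ where
  map_add U := U.map_add'
  map_smulₛₗ U := U.map_smul'

variable (U : LinftyCharacter μ)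

/-- The character is given by the point mass at an atom `ω` of `μ`, that is, by evaluation at a
point `ω` of positive measure. -/
def IsPointMass : Prop :=
  ∃ ω, μ {ω} ≠ 0 ∧ ∀ f : Lp ℂ ∞ μ, U f = f ω

theorem map_mul_of_ae {f g h : Lp ℂ ∞ μ} (H : ∀ᵐ ω ∂μ, h ω = f ω * g ω) : U h = U f * U g := by
  have : h = (f • g : Lp ℂ ∞ μ) := by
    apply Lp.ext
    filter_upwards [H, Lp.coeFn_lpSMul (r := ∞) f g] with ω h1 h2
    rw [h1, h2]
    rfl
  rw [this]
  exact U.map_mul' f g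

theorem map_eq_one {f : Lp ℂ ∞ μ} (hf : ∀ᵐ ω ∂μ, f ω = 1) : U f = 1 := by
  obtain ⟨g, hg⟩ := U.exists_ne_zero
  have h : U g = U f * U g := U.map_mul_of_ae (by
    filter_upwards [hf] with ω h
    simp [h])
  exact (mul_eq_right₀ hg).1 h.symm

theorem ne_zero_of_inv {f : Lp ℂ ∞ μ} {c : ℝ} (hc : 0 < c) (hf : ∀ᵐ ω ∂μ, c ≤ ‖f ω‖) :
    U f ≠ 0 := by
  have hg : MemLp (fun ω => (f ω)⁻¹) ∞ μ := by
    refine memLp_top_of_bound (Lp.aestronglyMeasurable f).aemeasurable.inv.aestronglyMeasurable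
      c⁻¹ ?_
    filter_upwards [hf] with ω h
    rw [norm_inv]
    exact inv_anti₀ hc h
  have h1 : MemLp (fun ω => f ω * (f ω)⁻¹) ∞ μ := by
    refine memLp_top_of_bound ((Lp.aestronglyMeasurable f).mul hg.1) 1 (.of_forall fun ω => ?_)
    rw [norm_mul, norm_inv]
    exact mul_inv_le_one
  have h2 : U h1.toLp = 1 := U.map_eq_one (by
    filter_upwards [hf, h1.coeFn_toLp] with ω h h'
    rw [h', mul_inv_cancel₀ (norm_pos_iff.1 (hc.trans_le h))])
  have h3 : U h1.toLp = U f * U hg.toLp := U.map_mul_of_ae (by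
    filter_upwards [h1.coeFn_toLp, hg.coeFn_toLp] with ω h h'
    rw [h, h'])
  intro h0
  rw [h2, h0, zero_mul] at h3
  exact one_ne_zero h3

theorem nonneg {f : Lp ℂ ∞ μ} (hf : ∀ᵐ ω ∂μ, 0 ≤ f ω) : 0 ≤ U f := by
  -- `g` is the square root of `f`, whose value under `U` has to be real
  have hfm : AEMeasurable f μ := (Lp.aestronglyMeasurable f).aemeasurable
  have hgm : AEMeasurable (fun ω => ((√(f ω).re : ℝ) : ℂ)) μ :=
    Complex.measurable_ofReal.comp_aemeasurable (Complex.measurable_re.comp_aemeasurable hfm).sqrt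
  have hg : MemLp (fun ω => ((√(f ω).re : ℝ) : ℂ)) ∞ μ := by
    refine memLp_top_of_bound hgm.aestronglyMeasurable (√‖f‖) ?_
    have hb : ∀ᵐ ω ∂μ, ‖f ω‖ ≤ ‖f‖ := by
      filter_upwards [ae_le_eLpNormEssSup (f := f) (μ := μ)] with ω h
      rw [← eLpNorm_exponent_top, ← Lp.enorm_def] at h
      exact enorm_le_iff_norm_le.1 h
    filter_upwards [hb] with ω h
    rw [Complex.norm_real, Real.norm_of_nonneg (Real.sqrt_nonneg _)]
    exact Real.sqrt_le_sqrt ((Complex.re_le_norm _).trans h)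
  have h1 : U f = U hg.toLp * U hg.toLp := U.map_mul_of_ae (by
    filter_upwards [hf, hg.coeFn_toLp] with ω h h'
    rw [h', ← Complex.ofReal_mul, Real.mul_self_sqrt (Complex.nonneg_iff.1 h).1]
    exact Complex.ext rfl (Complex.nonneg_iff.1 h).2.symm)
  have h2 : (U hg.toLp).im = 0 := by
    by_contra him
    set z := U hg.toLp with hz
    obtain ⟨e, he⟩ : ∃ e : Lp ℂ ∞ μ, ∀ᵐ ω ∂μ, e ω = 1 := by
      have h : MemLp (fun _ : Ω => (1 : ℂ)) ∞ μ :=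
        memLp_top_of_bound aestronglyMeasurable_const 1 (.of_forall fun _ => by simp)
      exact ⟨h.toLp, h.coeFn_toLp⟩
    refine U.ne_zero_of_inv (f := hg.toLp - z • e) (abs_pos.2 him) ?_ ?_
    · filter_upwards [he, hg.coeFn_toLp, Lp.coeFn_sub hg.toLp (z • e), Lp.coeFn_smul z e]
        with ω h1 h2 h3 h4
      rw [h3, Pi.sub_apply, h4, Pi.smul_apply, h1, h2]
      refine le_trans (le_of_eq ?_) (Complex.abs_im_le_norm _)
      simp
    · rw [map_sub, map_smul, U.map_eq_one he, ← hz]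
      simp
  rw [h1, Complex.nonneg_iff]
  simp [Complex.mul_re, Complex.mul_im, h2, mul_self_nonneg]

end LinftyCharacter

namespace MeasurableField

variable {Ω : Type u} [MeasurableSpace Ω] {μ : Measure Ω} (M : MeasurableField.{u, v} μ)
  (U : LinftyCharacter μ)

/-- The tracial state `U ∘ E` on the direct integral. -/
def characterState : TracialState M.DirectIntegral where
  toLinearMap := U.toLinearMap ∘ₗ M.expectation
  map_one' := by
    refine U.map_eq_one ?_
    filter_upwards [M.expectation_toDirectIntegral 1] with ω h
    exact h.trans (M.tr ω).map_one
  nonneg' x := by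
    obtain ⟨f, rfl⟩ := M.toDirectIntegral_surjective x
    refine U.nonneg ?_
    rw [← map_star, ← map_mul]
    filter_upwards [M.expectation_toDirectIntegral (star f * f)] with ω h
    rw [h]
    exact (M.tr ω).nonneg (f.1 ω)
  tracial' x y := by
    obtain ⟨f, rfl⟩ := M.toDirectIntegral_surjective x
    obtain ⟨g, rfl⟩ := M.toDirectIntegral_surjective y
    change U _ = U _
    rw [← map_mul, ← map_mul]
    congr 1
    apply Lp.ext
    filter_upwards [M.expectation_toDirectIntegral (f * g), M.expectation_toDirectIntegral (g * f)]
      with ω h h'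
    rw [h, h']
    exact (M.tr ω).tracial _ _

theorem characterState_apply (x : M.DirectIntegral) :
    M.characterState U x = U (M.expectation x) := rfl

/-- The ultrafiber of the direct integral with respect to `E` and `U`: the quotient by the ideal
`{x | U (E (x⋆ x)) = 0}`. -/
def Ultrafiber : Type (max u v) := M.DirectIntegral ⧸ (M.characterState U).nullIdeal

instance : Ring (M.Ultrafiber U) :=
  inferInstanceAs (Ring (M.DirectIntegral ⧸ (M.characterState U).nullIdeal))
instance : StarRing (M.Ultrafiber U) :=
  inferInstanceAs (StarRing (M.DirectIntegral ⧸ (M.characterState U).nullIdeal))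
instance : Algebra ℂ (M.Ultrafiber U) :=
  inferInstanceAs (Algebra ℂ (M.DirectIntegral ⧸ (M.characterState U).nullIdeal))
instance : StarModule ℂ (M.Ultrafiber U) :=
  inferInstanceAs (StarModule ℂ (M.DirectIntegral ⧸ (M.characterState U).nullIdeal))

/-- The canonical trace `x + I ↦ U (E x)` on the ultrafiber. -/
def ultrafiberTrace : TracialState (M.Ultrafiber U) := (M.characterState U).quotientState

end MeasurableField

section VonNeumannNotions

variable (A : Type u) [Ring A] [StarRing A]

variable {A} in
/-- A minimal projection: a nonzero projection whose only subprojections are `0` and itself. -/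
def IsMinimalProjection (q : A) : Prop :=
  IsStarProjection q ∧ q ≠ 0 ∧ ∀ r : A, IsStarProjection r → q * r = r → r = 0 ∨ r = q

/-- For a von Neumann algebra `A`: there is a nonzero central projection `p` such that `p A` is
diffuse, that is, has no minimal projections (the projections of `p A` are those below `p`). -/
def HasDiffuseSummand : Prop :=
  ∃ p : A, IsStarProjection p ∧ p ∈ Set.center A ∧ p ≠ 0 ∧
    ∀ q : A, IsMinimalProjection q → p * q ≠ q

open scoped Matrix.Norms.L2Operator in
/-- `A` is isomorphic, as a `*`-algebra, to the von Neumann algebraic (that is, `ℓ^∞`) direct sum of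
countably many full matrix algebras `M_{d i}(ℂ)`, `d i ≥ 1`, with their operator norms. -/
def IsDirectSumOfMatrixAlgebras [Algebra ℂ A] : Prop :=
  ∃ (I : Type) (_ : Countable I) (d : I → ℕ) (_ : ∀ i, NeZero (d i)),
    Nonempty (A ≃⋆ₐ[ℂ] lp (fun i => Matrix (Fin (d i)) (Fin (d i)) ℂ) ∞)

end VonNeumannNotions

/-- The density character: the minimal cardinality of a dense subset. -/
def densityCharacter (X : Type u) [TopologicalSpace X] : Cardinal.{u} :=
  sInf {κ | ∃ s : Set X, Dense s ∧ Cardinal.mk s = κ}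

end

/-! The character `U` is a limit: it defines a filter on `Ω` that lies below `ae μ`, decides every
measurable set and satisfies `f ω → U f` for every `f` in `L^∞` (`tendsto_filter`). Hence the trace
and the 2-norm of the ultrafiber are limits of the fiberwise ones (`tendsto_tr`, `tendsto_norm2`).

A standard Borel space has a countable family of measurable sets that separates points. If `U` is
not a point mass, the filter therefore contains countably many measurable sets with empty
intersection (`exists_iInter_eq_empty`). These give an index function `m : Ω → ℕ` that tends to
infinity along the filter while `ω` still satisfies the `m ω`-th of a given sequence of conditions
(`exists_index`). Bounded sections can be glued along `m` (`exists_glue`), which is a form of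
countable saturation. Truncation by functional calculus (`exists_bounded_lift`) supplies lifts with
a uniform bound, as the gluing requires.

Saturation is used twice. First, 2-norm Cauchy sequences that are uniformly bounded as left
multiplications converge in the ultrafiber. With fiberwise functional calculus this gives the four
axioms of `IsCompleteTracial`, on which the whole structure theory rests; `OpBound` plays the role
of the operator norm. Secondly, if there is a diffuse summand with unit `p`, repeated halving of
projections (`exists_half`) gives, for each `n`, `2^n` trace-orthogonal self-adjoint unitaries of
the summand. Lifting them and gluing along the initial segments of each binary sequence produces
continuum many elements at a mutual distance of at least `‖p‖₂ / 2`. Conversely, the ultrafiber has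
at most continuum many elements, since a section is determined almost everywhere by countably many
measurable functions (`mk_ultrafiber_le`).

Without a diffuse summand, every nonzero central projection dominates a minimal projection. A
minimal projection has a scalar corner (`corner_scalar`), and a maximal orthogonal family of
equivalent copies of it sums to a central projection (`exists_matrixBlock`). The units of these
blocks are equal or orthogonal, so there are countably many of them, and they sum to `1`. The matrix
entries over all blocks then give the isomorphism with the `ℓ^∞`-sum, and the countably many matrix
units span a dense subspace. -/

open Filter Topology

set_option linter.unusedSectionVars false

/-! ### The 2-norm, boundedness of left multiplications, and convergence in 2-norm -/

namespace TracialState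

section L2Norm

variable {A : Type u} [Ring A] [StarRing A] [Algebra ℂ A] [StarModule ℂ A] (τ : TracialState A)

theorem norm2_add_le (x y : A) : τ.norm2 (x + y) ≤ τ.norm2 x + τ.norm2 y :=
  norm_add_le (show L2 A τ from x) (show L2 A τ from y)

theorem norm2_sub_rev (x y : A) : τ.norm2 (x - y) = τ.norm2 (y - x) :=
  norm_sub_rev (show L2 A τ from x) (show L2 A τ from y)

theorem norm2_sub_le_norm2_sub_add (x y z : A) :
    τ.norm2 (x - z) ≤ τ.norm2 (x - y) + τ.norm2 (y - z) :=
  norm_sub_le_norm_sub_add_norm_sub (show L2 A τ from x) (show L2 A τ from y)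
    (show L2 A τ from z)

@[simp] theorem norm2_zero : τ.norm2 (0 : A) = 0 := by simp [norm2]

theorem apply_star_mul_self (x : A) : τ (star x * x) = ((τ.norm2 x ^ 2 : ℝ) : ℂ) := by
  rw [τ.norm2_sq]
  exact Complex.ext rfl (Complex.nonneg_iff.1 (τ.nonneg x)).2.symm

theorem apply_projection {q : A} (hq : IsStarProjection q) :
    τ q = ((τ.norm2 q ^ 2 : ℝ) : ℂ) := by
  rw [← apply_star_mul_self, hq.isSelfAdjoint.star_eq, hq.isIdempotentElem.eq]

theorem norm2_sq_projection {q : A} (hq : IsStarProjection q) : τ.norm2 q ^ 2 = (τ q).re := by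
  rw [τ.apply_projection hq, Complex.ofReal_re]

theorem norm2_mul_sq (x y : A) : τ.norm2 (x * y) ^ 2 = (τ (star y * (star x * x) * y)).re := by
  rw [norm2_sq, star_mul]
  simp only [mul_assoc]

/-- Left multiplication by `x` is bounded by `C` with respect to the `L²`-norm. -/
def OpBound (C : ℝ) (x : A) : Prop := ∀ y, τ.norm2 (x * y) ≤ C * τ.norm2 y

/-- Convergence in the `L²`-norm. -/
def TendstoL2 (x : ℕ → A) (l : A) : Prop := Tendsto (fun n => τ.norm2 (x n - l)) atTop (𝓝 0)

variable {τ}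

theorem OpBound.mono {C D : ℝ} {x : A} (h : τ.OpBound C x) (hCD : C ≤ D) : τ.OpBound D x :=
  fun y => (h y).trans (mul_le_mul_of_nonneg_right hCD (τ.norm2_nonneg y))

/-- Cauchy–Schwarz gives `‖x⋆ y‖₂² = τ(y⋆ x x⋆ y) ≤ ‖y‖₂ · C ‖x⋆ y‖₂`, and one factor cancels. If
`‖x⋆ y‖₂ = 0`, only the sign of `C ‖y‖₂` matters. -/
theorem OpBound.star {C : ℝ} {x : A} (h : τ.OpBound C x) : τ.OpBound C (star x) := by
  intro y
  have h1 : τ.norm2 (Star.star x * y) ^ 2 ≤ τ.norm2 y * (C * τ.norm2 (Star.star x * y)) := by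
    rw [norm2_sq, star_mul, star_star, mul_assoc]
    refine (Complex.re_le_norm _).trans ((τ.norm_apply_star_mul_le _ _).trans ?_)
    exact mul_le_mul_of_nonneg_left (h _) (τ.norm2_nonneg y)
  rcases (τ.norm2_nonneg (Star.star x * y)).eq_or_lt with h0 | h0
  · rw [← h0]
    by_contra! hc
    have h2 : C < 0 := by
      by_contra! hC
      exact absurd hc (not_lt.2 (mul_nonneg hC (τ.norm2_nonneg y)))
    have := (τ.norm2_nonneg _).trans (h y)
    linarith
  · nlinarith

theorem OpBound.add {C D : ℝ} {x y : A} (hx : τ.OpBound C x) (hy : τ.OpBound D y) :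
    τ.OpBound (C + D) (x + y) := by
  intro w
  rw [add_mul, add_mul]
  exact (τ.norm2_add_le _ _).trans (add_le_add (hx w) (hy w))

theorem OpBound.smul {C : ℝ} {x : A} (hx : τ.OpBound C x) (c : ℂ) :
    τ.OpBound (‖c‖ * C) (c • x) := by
  intro w
  rw [smul_mul_assoc, norm2_smul, mul_assoc]
  exact mul_le_mul_of_nonneg_left (hx w) (norm_nonneg _)

theorem OpBound.mul {C D : ℝ} {x y : A} (hC : 0 ≤ C) (hx : τ.OpBound C x) (hy : τ.OpBound D y) :
    τ.OpBound (C * D) (x * y) := by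
  intro w
  rw [mul_assoc, mul_assoc]
  exact (hx _).trans (mul_le_mul_of_nonneg_left (hy w) hC)

theorem opBound_one : τ.OpBound 1 (1 : A) := fun y => by simp

/-- If `x⋆ x + w⋆ w = C² z`, then `‖x y‖₂² ≤ C² τ(y⋆ z y)`. -/
theorem norm2_mul_sq_le_of_add_eq {C : ℝ} {x w z : A}
    (h : star x * x + star w * w = ((C ^ 2 : ℝ) : ℂ) • z) (y : A) :
    τ.norm2 (x * y) ^ 2 ≤ C ^ 2 * (τ (star y * z * y)).re := by
  have h1 : τ.norm2 (x * y) ^ 2 + τ.norm2 (w * y) ^ 2 = C ^ 2 * (τ (star y * z * y)).re := by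
    rw [norm2_mul_sq, norm2_mul_sq, ← Complex.add_re, ← map_add, ← add_mul, ← mul_add, h]
    simp only [mul_smul_comm, smul_mul_assoc, map_smul, smul_eq_mul, Complex.re_ofReal_mul]
  nlinarith [sq_nonneg (τ.norm2 (w * y))]

/-- The decomposition `q + (1 - q) = 1` exhibits `1 - q⋆ q` as a square, so left multiplication by
`q` is a contraction. -/
theorem opBound_of_projection {q : A} (hq : IsStarProjection q) : τ.OpBound 1 q := by
  intro y
  have h := norm2_mul_sq_le_of_add_eq (τ := τ) (C := 1) (x := q) (w := 1 - q) (z := 1) (by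
    rw [hq.isSelfAdjoint.star_eq, hq.isIdempotentElem.eq, hq.one_sub.isSelfAdjoint.star_eq,
      hq.one_sub.isIdempotentElem.eq]
    simp) y
  rw [mul_one, ← norm2_sq] at h
  rw [one_mul]
  exact abs_le_of_sq_le_sq' (by simpa using h) (τ.norm2_nonneg _) |>.2

theorem opBound_of_star_mul_self_projection {x : A} (hx : IsStarProjection (star x * x)) :
    τ.OpBound 1 x := by
  intro y
  have h := opBound_of_projection (τ := τ) hx y
  have h1 : τ.norm2 (x * y) ^ 2 = τ.norm2 (star x * x * y) ^ 2 := by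
    rw [norm2_mul_sq, norm2_mul_sq, hx.isSelfAdjoint.star_eq, hx.isIdempotentElem.eq]
  rwa [(sq_eq_sq₀ (τ.norm2_nonneg _) (τ.norm2_nonneg _)).1 h1]

theorem norm2_projection_le_one {q : A} (hq : IsStarProjection q) : τ.norm2 q ≤ 1 := by
  have h := opBound_of_projection (τ := τ) hq 1
  have h1 : τ.norm2 (1 : A) = 1 := by simp [norm2, τ.map_one]
  simpa [h1] using h

theorem tendstoL2_const (a : A) : τ.TendstoL2 (fun _ => a) a := by
  simp [TendstoL2]

theorem TendstoL2.congr {x y : ℕ → A} {l : A} (h : τ.TendstoL2 x l) (hxy : ∀ᶠ n in atTop, x n = y n) :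
    τ.TendstoL2 y l := by
  refine Tendsto.congr' ?_ h
  filter_upwards [hxy] with n hn
  rw [hn]

theorem TendstoL2.comp {x : ℕ → A} {l : A} (h : τ.TendstoL2 x l) {φ : ℕ → ℕ}
    (hφ : Tendsto φ atTop atTop) : τ.TendstoL2 (fun n => x (φ n)) l :=
  Tendsto.comp (g := fun n => τ.norm2 (x n - l)) h hφ

theorem TendstoL2.star {x : ℕ → A} {l : A} (h : τ.TendstoL2 x l) :
    τ.TendstoL2 (fun n => star (x n)) (star l) := by
  unfold TendstoL2 at h ⊢
  simp only [← star_sub, norm2_star]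
  exact h

theorem TendstoL2.add {x y : ℕ → A} {l m : A} (hx : τ.TendstoL2 x l) (hy : τ.TendstoL2 y m) :
    τ.TendstoL2 (fun n => x n + y n) (l + m) := by
  refine squeeze_zero (fun n => τ.norm2_nonneg _) (fun n => ?_) (by simpa using Tendsto.add hx hy)
  rw [add_sub_add_comm]
  exact τ.norm2_add_le _ _

theorem TendstoL2.smul {x : ℕ → A} {l : A} (h : τ.TendstoL2 x l) (c : ℂ) :
    τ.TendstoL2 (fun n => c • x n) (c • l) := by
  unfold TendstoL2 at h ⊢
  simp only [← smul_sub, norm2_smul]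
  simpa using h.const_mul ‖c‖

theorem TendstoL2.sub {x y : ℕ → A} {l m : A} (hx : τ.TendstoL2 x l) (hy : τ.TendstoL2 y m) :
    τ.TendstoL2 (fun n => x n - y n) (l - m) := by
  simpa [sub_eq_add_neg] using hx.add (hy.smul (-1))

theorem TendstoL2.norm2 {x : ℕ → A} {l : A} (h : τ.TendstoL2 x l) :
    Tendsto (fun n => τ.norm2 (x n)) atTop (𝓝 (τ.norm2 l)) := by
  rw [tendsto_iff_dist_tendsto_zero]
  refine squeeze_zero (fun n => dist_nonneg) (fun n => ?_) h
  exact abs_norm_sub_norm_le (show L2 A τ from x n) (show L2 A τ from l)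

variable (τ) in
/-- The abstract properties of a tracial von Neumann algebra that are used below: the trace is
faithful, every element is bounded as an operator on `L²`, the operator norm balls are complete for
the `L²`-metric, and every self-adjoint element has a positive and a negative part. -/
structure IsCompleteTracial : Prop where
  faithful : ∀ x, τ (star x * x) = 0 → x = 0
  bounded : ∀ x, ∃ C, 0 < C ∧ τ.OpBound C x
  complete : ∀ (C : ℝ) (x : ℕ → A), (∀ n, τ.OpBound C (x n)) →
    (∀ ε > 0, ∃ N, ∀ m ≥ N, ∀ n ≥ N, τ.norm2 (x m - x n) < ε) → ∃ l, τ.TendstoL2 x l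
  decomp : ∀ x : A, IsSelfAdjoint x → ∃ y z : A, IsSelfAdjoint y ∧ IsSelfAdjoint z ∧ y * z = 0 ∧
    x = y * y - z * z

namespace IsCompleteTracial

variable (h : τ.IsCompleteTracial)
include h

theorem eq_zero {x : A} (hx : τ.norm2 x = 0) : x = 0 :=
  h.faithful x ((τ.apply_eq_zero_iff x).2 hx)

theorem norm2_pos {x : A} (hx : x ≠ 0) : 0 < τ.norm2 x :=
  (τ.norm2_nonneg x).lt_of_ne fun h0 => hx (h.eq_zero h0.symm)

theorem mul_left {x : ℕ → A} {l : A} (hx : τ.TendstoL2 x l) (a : A) :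
    τ.TendstoL2 (fun n => a * x n) (a * l) := by
  obtain ⟨C, -, hC⟩ := h.bounded a
  refine squeeze_zero (fun n => τ.norm2_nonneg _) (fun n => ?_) (by simpa using hx.const_mul C)
  rw [← mul_sub]
  exact hC _

theorem mul_right {x : ℕ → A} {l : A} (hx : τ.TendstoL2 x l) (a : A) :
    τ.TendstoL2 (fun n => x n * a) (l * a) := by
  simpa using (h.mul_left hx.star (star a)).star

theorem unique {x : ℕ → A} {l m : A} (hl : τ.TendstoL2 x l) (hm : τ.TendstoL2 x m) : l = m := by
  have h1 := (hl.sub hm).norm2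
  simp only [sub_self, norm2_zero] at h1
  exact sub_eq_zero.1 (h.eq_zero (tendsto_nhds_unique h1 tendsto_const_nhds))

theorem star_mul_self_eq_zero {x : A} (hx : star x * x = 0) : x = 0 :=
  h.faithful x (by rw [hx, map_zero])

theorem mul_eq_zero_of_sq_mul {y w : A} (hy : IsSelfAdjoint y) (hw : y * (y * w) = 0) :
    y * w = 0 := by
  apply h.star_mul_self_eq_zero
  rw [star_mul, hy.star_eq, mul_assoc, hw, mul_zero]

theorem eq_zero_of_mul_self {y : A} (hy : IsSelfAdjoint y) (hw : τ (y * y) = 0) : y = 0 :=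
  h.faithful y (by rwa [hy.star_eq])

end IsCompleteTracial

end L2Norm

end TracialState

/-! ### Support projections and the corner of a minimal projection -/

namespace TracialState
namespace IsCompleteTracial

variable {A : Type u} [Ring A] [StarRing A] [Algebra ℂ A] [StarModule ℂ A] {τ : TracialState A}
variable (h : τ.IsCompleteTracial)
include h

/-- The numbers `‖a ^ n‖₂²` decrease, hence converge. Even exponents make the inner product of two
terms again such a number, so all mutual distances are determined by this sequence and tend to `0`.
-/
theorem pow_tendsto {a : A} (ha : IsSelfAdjoint a) (hb : τ.OpBound 1 a) :
    ∃ l, τ.TendstoL2 (fun n => a ^ (2 * n)) l := by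
  have hpow : ∀ k, τ.OpBound 1 (a ^ k) := by
    intro k
    induction k with
    | zero => simpa using opBound_one
    | succ k ih => simpa [pow_succ'] using OpBound.mul zero_le_one hb ih
  set t : ℕ → ℝ := fun n => τ.norm2 (a ^ n) ^ 2 with ht
  have hanti : Antitone t := by
    refine antitone_nat_of_succ_le fun n => ?_
    have := hb (a ^ n)
    rw [one_mul, ← pow_succ'] at this
    exact pow_le_pow_left₀ (τ.norm2_nonneg _) this 2
  have hlim := tendsto_atTop_ciInf hanti ⟨0, by rintro _ ⟨n, rfl⟩; positivity⟩
  set L := ⨅ n, t n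
  have hτ : ∀ n m, (τ (a ^ (2 * n) * a ^ (2 * m))).re = t (n + m) := by
    intro n m
    rw [ht]
    simp only
    rw [norm2_sq, (ha.pow _).star_eq, ← pow_add, ← pow_add]
    congr 3
    ring
  have hdist : ∀ n m, τ.norm2 (a ^ (2 * n) - a ^ (2 * m)) ^ 2 =
      t (n + n) - 2 * t (n + m) + t (m + m) := by
    intro n m
    rw [norm2_sq, star_sub, (ha.pow _).star_eq, (ha.pow _).star_eq, sub_mul, mul_sub, mul_sub,
      map_sub, map_sub, map_sub, Complex.sub_re, Complex.sub_re, Complex.sub_re, hτ, hτ, hτ, hτ,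
      add_comm m n]
    ring
  refine h.complete 1 _ (fun n => hpow _) fun ε hε => ?_
  obtain ⟨N, hN⟩ := (Metric.tendsto_atTop.1 hlim) (ε ^ 2 / 4) (by positivity)
  refine ⟨N, fun m hm n hn => ?_⟩
  refine lt_of_pow_lt_pow_left₀ 2 hε.le ?_
  rw [hdist]
  have h1 := hN (m + m) (by omega)
  have h2 := hN (m + n) (by omega)
  have h3 := hN (n + n) (by omega)
  rw [Real.dist_eq, abs_lt] at h1 h2 h3
  linarith

/-- Every self-adjoint element has a support projection. -/
theorem exists_support {y : A} (hy : IsSelfAdjoint y) :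
    ∃ e, IsStarProjection e ∧ y * e = y ∧ ∀ w, y * w = 0 → e * w = 0 := by
  obtain ⟨C, hC, hyC⟩ := h.bounded y
  have hC' : (C : ℂ) ≠ 0 := by exact_mod_cast hC.ne'
  obtain ⟨b, hb, hb1, hyb, hyb'⟩ : ∃ b : A, IsSelfAdjoint b ∧ τ.OpBound 1 b ∧
      (∀ w, y * w = 0 → b * w = 0) ∧ (∀ w, b * w = 0 → y * w = 0) := by
    refine ⟨((C⁻¹ : ℝ) : ℂ) • y, ?_, ?_, fun w hw => by simp [hw], fun w hw => ?_⟩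
    · rw [IsSelfAdjoint, star_smul, hy.star_eq, Complex.star_def, Complex.conj_ofReal]
    · have := hyC.smul ((C⁻¹ : ℝ) : ℂ)
      rw [Complex.norm_real, Real.norm_of_nonneg (by positivity), inv_mul_cancel₀ hC.ne'] at this
      exact this
    · rw [smul_mul_assoc] at hw
      simpa [hC'] using hw
  -- The even powers of `a` converge to the projection onto the kernel of `b`; its complement is the
  -- support.
  set a : A := 1 - b * b with ha_def
  have ha : IsSelfAdjoint a := (IsSelfAdjoint.one A).sub (by simp [IsSelfAdjoint, hb.star_eq])
  have hnorm : ∀ w, τ.norm2 (a * w) ^ 2 ≤ τ.norm2 w ^ 2 - τ.norm2 (b * w) ^ 2 := by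
    intro w
    have h1 : τ.norm2 (a * w) ^ 2 = τ.norm2 w ^ 2 - 2 * τ.norm2 (b * w) ^ 2 +
        τ.norm2 (b * (b * w)) ^ 2 := by
      simp only [norm2_sq, star_mul, ha.star_eq, hb.star_eq]
      have : star w * a * (a * w) = star w * w - (star w * b * (b * w) + star w * b * (b * w))
          + star w * b * b * (b * (b * w)) := by
        rw [ha_def]; noncomm_ring
      rw [this, map_add, map_sub, map_add, Complex.add_re, Complex.sub_re, Complex.add_re]
      ring
    have h2 := hb1 (b * w)
    rw [one_mul] at h2
    have := pow_le_pow_left₀ (τ.norm2_nonneg _) h2 2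
    linarith
  have ha1 : τ.OpBound 1 a := by
    intro w
    rw [one_mul]
    refine (pow_le_pow_iff_left₀ (τ.norm2_nonneg _) (τ.norm2_nonneg _) two_ne_zero).1 ?_
    have := hnorm w
    have := sq_nonneg (τ.norm2 (b * w))
    linarith
  obtain ⟨l, hl⟩ := h.pow_tendsto ha ha1
  have hls : IsSelfAdjoint l := by
    refine h.unique (hl.star.congr (.of_forall fun n => ?_)) hl
    exact (ha.pow _).star_eq
  have hal : a * (a * l) = l := by
    refine h.unique (h.mul_left (h.mul_left hl a) a) ((hl.comp (tendsto_add_atTop_nat 1)).congr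
      (.of_forall fun n => ?_))
    rw [← pow_succ', ← pow_succ']
    congr 1
  -- From `a² l = l` one gets `‖a l‖₂ = ‖l‖₂`, so the gap `‖b l‖₂²` in `hnorm` has to vanish.
  have hbl : b * l = 0 := by
    apply h.eq_zero
    have h1 := hnorm l
    have h2 : τ.norm2 (a * l) ^ 2 = τ.norm2 l ^ 2 := by
      rw [norm2_sq, norm2_sq, star_mul, ha.star_eq, mul_assoc, hal]
    have h3 := sq_nonneg (τ.norm2 (b * l))
    exact pow_eq_zero_iff two_ne_zero |>.1 (le_antisymm (by linarith) h3)
  have hfix : ∀ w, b * w = 0 → l * w = w := by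
    intro w hw
    refine h.unique (h.mul_right hl w) ((tendstoL2_const w).congr (.of_forall fun n => ?_))
    have h1 : a * w = w := by rw [ha_def, sub_mul, one_mul, mul_assoc, hw, mul_zero, sub_zero]
    generalize 2 * n = k
    induction k with
    | zero => simp
    | succ k ih => rw [pow_succ, mul_assoc, h1, ← ih]
  have hlp : IsStarProjection l := ⟨hfix l hbl, hls⟩
  refine ⟨1 - l, hlp.one_sub, ?_, fun w hw => ?_⟩
  · rw [mul_sub, mul_one, hyb' l hbl, sub_zero]
  · rw [sub_mul, one_mul, hfix w (hyb w hw), sub_self]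

/-- Subtract the multiple of `q` with the same trace and split the difference into orthogonal
positive and negative parts. The support of the positive part lies below `q`, so minimality leaves
only `0` and `q`. In either case one of the parts vanishes, and trace zero kills the other. -/
theorem corner_scalar_selfAdjoint {q : A} (hq : IsMinimalProjection q) {x : A}
    (hx : IsSelfAdjoint x) (hxq : x * q = x) : ∃ c : ℂ, x = c • q := by
  obtain ⟨hqp, hq0, hmin⟩ := hq
  have hqs := hqp.isSelfAdjoint.star_eq
  have hτq : τ q ≠ 0 := by
    rw [τ.apply_projection hqp]
    exact_mod_cast (pow_pos (h.norm2_pos hq0) 2).ne'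
  set c : ℂ := (((τ x).re / (τ q).re : ℝ) : ℂ) with hc
  have hqim : (τ q) = ((τ q).re : ℂ) := by
    rw [← τ.norm2_sq_projection hqp, τ.apply_projection hqp]
  have hxim : (τ x) = ((τ x).re : ℂ) := by
    have := τ.map_star x
    rw [hx.star_eq] at this
    exact (Complex.conj_eq_iff_re.1 this.symm).symm
  have hcs : IsSelfAdjoint (x - c • q) := by
    rw [IsSelfAdjoint, star_sub, star_smul, hx.star_eq, hqs, hc, Complex.star_def,
      Complex.conj_ofReal]
  refine ⟨c, sub_eq_zero.1 ?_⟩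
  have hτ0 : τ (x - c • q) = 0 := by
    have : c * τ q = τ x := by
      rw [hc, Complex.ofReal_div, ← hqim, ← hxim, div_mul_cancel₀ _ hτq]
    rw [map_sub, map_smul, smul_eq_mul, this, sub_self]
  have hq1 : (x - c • q) * (1 - q) = 0 := by
    rw [mul_sub, mul_one, sub_mul, hxq, smul_mul_assoc, hqp.isIdempotentElem.eq, sub_self]
  obtain ⟨y, z, hy, hz, hyz, hd⟩ := h.decomp _ hcs
  have hzy : z * y = 0 := by
    have := congrArg star hyz
    rwa [star_mul, hy.star_eq, hz.star_eq, star_zero] at this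
  rw [hd] at hq1 hτ0 ⊢
  have key : ∀ y z : A, IsSelfAdjoint y → y * z = 0 → (y * y - z * z) * (1 - q) = 0 →
      y * q = y := by
    intro y z hy hyz h1
    -- Multiplying by `y` removes the opposite part; the surplus powers of `y` are then cancelled by
    -- faithfulness.
    have h2 : y * (y * (y * (1 - q))) = 0 := by
      have := congrArg (y * ·) h1
      simp only [mul_zero] at this
      have h3 : y * ((y * y - z * z) * (1 - q)) = y * (y * (y * (1 - q))) -
          y * z * (z * (1 - q)) := by noncomm_ring
      rwa [h3, hyz, zero_mul, sub_zero] at this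
    have h3 := h.mul_eq_zero_of_sq_mul hy (h.mul_eq_zero_of_sq_mul hy h2)
    rwa [mul_sub, mul_one, sub_eq_zero, eq_comm] at h3
  have hyq := key y z hy hyz hq1
  have hzq := key z y hz hzy (by
    rw [← neg_sub, neg_mul, hq1, neg_zero])
  obtain ⟨e, he, hye, hew⟩ := h.exists_support hy
  have heq : e * q = e := by
    have := hew (1 - q) (by rw [mul_sub, mul_one, hyq, sub_self])
    rwa [mul_sub, mul_one, sub_eq_zero, eq_comm] at this
  have hqe : q * e = e := by
    have := congrArg star heq
    rwa [star_mul, hqs, he.isSelfAdjoint.star_eq] at this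
  rcases hmin e he hqe with h0 | h0
  · have hy0 : y = 0 := by rw [← hye, h0, mul_zero]
    rw [hy0, mul_zero, zero_sub, map_neg, neg_eq_zero] at hτ0
    rw [hy0, h.eq_zero_of_mul_self hz hτ0]
    simp
  · have hez : q * z = 0 := by rw [← h0]; exact hew z hyz
    have hz0 : z = 0 := by
      have := congrArg star hez
      rwa [star_mul, hqs, hz.star_eq, star_zero, hzq] at this
    rw [hz0, mul_zero, sub_zero] at hτ0
    rw [hz0, h.eq_zero_of_mul_self hy hτ0]
    simp

/-- The corner of a minimal projection is one-dimensional. -/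
theorem corner_scalar {q : A} (hq : IsMinimalProjection q) (x : A) :
    ∃ c : ℂ, q * x * q = c • q := by
  have hqs := hq.1.isSelfAdjoint.star_eq
  have hqq := hq.1.isIdempotentElem.eq
  have key : ∀ x : A, IsSelfAdjoint x → ∃ c : ℂ, q * x * q = c • q := by
    intro x hx
    refine h.corner_scalar_selfAdjoint hq ?_ (by rw [mul_assoc, hqq])
    simp [IsSelfAdjoint, hqs, hx.star_eq, mul_assoc]
  obtain ⟨c, hc⟩ := key (realPart x : A) (realPart x).2
  obtain ⟨d, hd⟩ := key (imaginaryPart x : A) (imaginaryPart x).2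
  refine ⟨c + Complex.I * d, ?_⟩
  conv_lhs => rw [← realPart_add_I_smul_imaginaryPart x]
  rw [mul_add, add_mul, hc, mul_smul_comm, smul_mul_assoc, hd, smul_smul, add_smul]

end IsCompleteTracial
end TracialState

/-! ### Limits of projections, and halving in a diffuse summand -/

namespace TracialState

variable {A : Type u} [Ring A] [StarRing A] [Algebra ℂ A] [StarModule ℂ A] {τ : TracialState A}

theorem star_projection_mul_comm {p q : A} (hp : IsStarProjection p) (hq : IsStarProjection q)
    (h : p * q = q) : q * p = q := by
  have := congrArg star h
  rwa [star_mul, hp.isSelfAdjoint.star_eq, hq.isSelfAdjoint.star_eq] at this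

theorem isStarProjection_sub {p q : A} (hp : IsStarProjection p) (hq : IsStarProjection q)
    (h : p * q = q) : IsStarProjection (p - q) :=
  hq.sub_of_mul_eq_left hp (star_projection_mul_comm hp hq h)

theorem norm2_sq_sub_projection {p q : A} (hp : IsStarProjection p) (hq : IsStarProjection q)
    (h : p * q = q) : τ.norm2 (p - q) ^ 2 = τ.norm2 p ^ 2 - τ.norm2 q ^ 2 := by
  rw [norm2_sq_projection _ (isStarProjection_sub hp hq h), map_sub, Complex.sub_re,
    norm2_sq_projection _ hp, norm2_sq_projection _ hq]

theorem norm2_sq_add_projection {p q : A} (hp : IsStarProjection p) (hq : IsStarProjection q)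
    (h : p * q = 0) : τ.norm2 (p + q) ^ 2 = τ.norm2 p ^ 2 + τ.norm2 q ^ 2 := by
  rw [norm2_sq_projection _ (hp.add hq h), map_add, Complex.add_re,
    norm2_sq_projection _ hp, norm2_sq_projection _ hq]

namespace IsCompleteTracial

variable (h : τ.IsCompleteTracial)
include h

/-- An increasing sequence of projections converges to a projection. -/
theorem exists_tendsto_projection {r : ℕ → A} (hr : ∀ n, IsStarProjection (r n))
    (hmono : ∀ n, r (n + 1) * r n = r n) :
    ∃ e, IsStarProjection e ∧ τ.TendstoL2 r e ∧ ∀ n, e * r n = r n := by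
  have hle : ∀ n k, n ≤ k → r k * r n = r n := by
    intro n k hnk
    induction k, hnk using Nat.le_induction with
    | base => exact (hr n).isIdempotentElem.eq
    | succ k hk ih => rw [← ih, ← mul_assoc, hmono]
  set t : ℕ → ℝ := fun n => τ.norm2 (r n) ^ 2
  have hd : ∀ n k, n ≤ k → τ.norm2 (r k - r n) ^ 2 = t k - t n := fun n k hnk =>
    norm2_sq_sub_projection (hr k) (hr n) (hle n k hnk)
  have hmon : Monotone t := fun n k hnk => by
    have := hd n k hnk
    have := sq_nonneg (τ.norm2 (r k - r n))
    linarith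
  have hlim := tendsto_atTop_ciSup hmon ⟨1, by
    rintro _ ⟨n, rfl⟩
    exact pow_le_one₀ (τ.norm2_nonneg _) (norm2_projection_le_one (hr n))⟩
  obtain ⟨e, he⟩ := h.complete 1 r (fun n => opBound_of_projection (hr n)) (by
    intro ε hε
    obtain ⟨N, hN⟩ := Metric.cauchySeq_iff.1 hlim.cauchySeq (ε ^ 2) (by positivity)
    refine ⟨N, fun m hm n hn => lt_of_pow_lt_pow_left₀ 2 hε.le ?_⟩
    have h1 := abs_lt.1 (hN m hm n hn)
    rcases le_total n m with hnm | hnm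
    · rw [hd n m hnm]; exact h1.2
    · rw [norm2_sub_rev, hd m n hnm]; linarith [h1.1])
  have hen : ∀ n, e * r n = r n := fun n =>
    h.unique (h.mul_right he (r n)) ((tendstoL2_const (r n)).congr (by
      filter_upwards [eventually_ge_atTop n] with k hk
      exact (hle n k hk).symm))
  refine ⟨e, ⟨?_, ?_⟩, he, hen⟩
  · exact h.unique (h.mul_left he e) (he.congr (.of_forall fun n => (hen n).symm))
  · exact h.unique he.star (he.congr (.of_forall fun n => (hr n).isSelfAdjoint.star_eq.symm))

section Diffuse

variable {p : A} (hp : IsStarProjection p) (hdiff : ∀ q : A, IsMinimalProjection q → p * q ≠ q)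
include hp hdiff

/-- A projection that is not minimal splits into two nonzero orthogonal pieces, one of which has at
most half the trace. This is repeated `n` times. -/
theorem exists_small_projection (n : ℕ) {q : A} (hq : IsStarProjection q) (hpq : p * q = q)
    (hq0 : q ≠ 0) : ∃ e, IsStarProjection e ∧ q * e = e ∧ e ≠ 0 ∧
      2 ^ n * τ.norm2 e ^ 2 ≤ τ.norm2 q ^ 2 := by
  induction n with
  | zero => exact ⟨q, hq, hq.isIdempotentElem.eq, hq0, by simp⟩
  | succ n ih =>
    obtain ⟨e, he, hqe, he0, hen⟩ := ih
    have hpe : p * e = e := by rw [← hqe, ← mul_assoc, hpq]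
    have hnm : ¬ IsMinimalProjection e := fun hm => hdiff e hm hpe
    simp only [IsMinimalProjection, not_and, not_forall] at hnm
    obtain ⟨r, hr, her, hr2⟩ := hnm he he0
    rw [not_or] at hr2
    obtain ⟨hr0, hre⟩ := hr2
    have hsub := norm2_sq_sub_projection (τ := τ) he hr her
    rcases le_total (2 * τ.norm2 r ^ 2) (τ.norm2 e ^ 2) with hle | hle
    · refine ⟨r, hr, by rw [← her, ← mul_assoc, hqe], hr0, ?_⟩
      rw [pow_succ]
      have : (0 : ℝ) < 2 ^ n := by positivity
      nlinarith
    · refine ⟨e - r, isStarProjection_sub he hr her, ?_, sub_ne_zero.2 (Ne.symm hre), ?_⟩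
      · rw [mul_sub, hqe]
        nth_rewrite 1 [← her]
        rw [← mul_assoc, hqe, her]
      · rw [pow_succ, hsub]
        have : (0 : ℝ) < 2 ^ n := by positivity
        nlinarith

/-- A projection in a diffuse summand can be halved. -/
theorem exists_half {q : A} (hq : IsStarProjection q) (hpq : p * q = q) :
    ∃ r, IsStarProjection r ∧ q * r = r ∧ 2 * τ.norm2 r ^ 2 = τ.norm2 q ^ 2 := by
  -- A greedy construction replaces Zorn's lemma. `P` singles out the subprojections of `q` with at
  -- most half its trace, and `T r` collects the traces of those above `r`. Each step climbs at
  -- least half of the remaining way to `sSup (T r)`, so the limit is maximal.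
  let P : A → Prop := fun r => IsStarProjection r ∧ q * r = r ∧ 2 * τ.norm2 r ^ 2 ≤ τ.norm2 q ^ 2
  let T : A → Set ℝ := fun r => {x | ∃ r', P r' ∧ r' * r = r ∧ τ.norm2 r' ^ 2 = x}
  have hT : ∀ r, BddAbove (T r) := fun r => ⟨1, by
    rintro _ ⟨r', hr', -, rfl⟩
    exact pow_le_one₀ (τ.norm2_nonneg _) (norm2_projection_le_one hr'.1)⟩
  have step : ∀ r : {r // P r}, ∃ r' : {r // P r}, r'.1 * r.1 = r.1 ∧
      sSup (T r.1) ≤ 2 * τ.norm2 r'.1 ^ 2 - τ.norm2 r.1 ^ 2 := by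
    intro ⟨r, hr⟩
    rcases le_or_gt (sSup (T r)) (τ.norm2 r ^ 2) with hs | hs
    · exact ⟨⟨r, hr⟩, hr.1.isIdempotentElem.eq, by simp only; linarith⟩
    · obtain ⟨_, ⟨r', hr', hrr, rfl⟩, hlt⟩ := exists_lt_of_lt_csSup
        (⟨_, r, hr, hr.1.isIdempotentElem.eq, rfl⟩ : (T r).Nonempty)
        (show (sSup (T r) + τ.norm2 r ^ 2) / 2 < sSup (T r) by linarith)
      exact ⟨⟨r', hr'⟩, hrr, by simp only; linarith⟩
  choose g hg1 hg2 using step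
  let r : ℕ → {r // P r} := fun n => Nat.rec ⟨0, .zero A, by simp, by simp; positivity⟩
    (fun _ r => g r) n
  obtain ⟨e, he, hlim, hen⟩ := h.exists_tendsto_projection (r := fun n => (r n).1)
    (fun n => (r n).2.1) (fun n => hg1 (r n))
  have hqe : q * e = e := h.unique (h.mul_left hlim q)
    (hlim.congr (.of_forall fun n => (r n).2.2.1.symm))
  have hnorm := (hlim.norm2.pow 2)
  have hPe : P e := ⟨he, hqe, le_of_tendsto (hnorm.const_mul 2) (.of_forall fun n => (r n).2.2.2)⟩
  have hmax : ∀ r', P r' → r' * e = e → τ.norm2 r' ^ 2 ≤ τ.norm2 e ^ 2 := by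
    intro r' hr' hre
    have h1 : Tendsto (fun n => 2 * τ.norm2 (r (n + 1)).1 ^ 2 - τ.norm2 (r n).1 ^ 2) atTop
        (𝓝 (2 * τ.norm2 e ^ 2 - τ.norm2 e ^ 2)) :=
      ((hnorm.comp (tendsto_add_atTop_nat 1)).const_mul 2).sub hnorm
    have h2 : τ.norm2 r' ^ 2 ≤ 2 * τ.norm2 e ^ 2 - τ.norm2 e ^ 2 := by
      refine ge_of_tendsto h1 (.of_forall fun n => (le_csSup (hT _) ?_).trans (hg2 (r n)))
      exact ⟨r', hr', by rw [← hen n, ← mul_assoc, hre], rfl⟩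
    linarith
  refine ⟨e, he, hqe, le_antisymm hPe.2.2 ?_⟩
  -- If the trace fell short of one half, a subprojection `d` of `q - e` with trace below half of
  -- the deficit `τ(q) - 2 τ(e)` could be added to `e`, against maximality.
  by_contra! hlt
  have hf := isStarProjection_sub hq he hqe
  have hf0 : q - e ≠ 0 := by
    intro h0
    rw [sub_eq_zero] at h0
    rw [← h0] at hlt
    have := sq_nonneg (τ.norm2 q)
    linarith
  have hpf : p * (q - e) = q - e := by
    rw [mul_sub, hpq]
    nth_rewrite 1 [← hqe]
    rw [← mul_assoc, hpq, hqe]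
  obtain ⟨n, hn⟩ := pow_unbounded_of_one_lt (τ.norm2 (q - e) ^ 2 / ((τ.norm2 q ^ 2 - 2 * τ.norm2 e ^ 2) / 2))
    one_lt_two
  obtain ⟨d, hd, hfd, hd0, hdn⟩ := h.exists_small_projection hp hdiff n hf hpf hf0
  have hed : e * d = 0 := by
    rw [← hfd, ← mul_assoc, mul_sub, star_projection_mul_comm hq he hqe, he.isIdempotentElem.eq,
      sub_self, zero_mul]
  have hde : d * e = 0 := by
    have := congrArg star hed
    rwa [star_mul, hd.isSelfAdjoint.star_eq, he.isSelfAdjoint.star_eq, star_zero] at this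
  have hqd : q * d = d := by
    nth_rewrite 1 [← hfd]
    rw [← mul_assoc, mul_sub, hq.isIdempotentElem.eq, hqe, hfd]
  have hadd := norm2_sq_add_projection (τ := τ) he hd hed
  have hdpos := pow_pos (h.norm2_pos hd0) 2
  have := hmax (e + d) ⟨he.add hd hed, by rw [mul_add, hqe, hqd], by
    rw [hadd]
    rw [div_lt_iff₀ (by linarith)] at hn
    have h3 : 2 ^ n * τ.norm2 d ^ 2 < 2 ^ n * ((τ.norm2 q ^ 2 - 2 * τ.norm2 e ^ 2) / 2) :=
      hdn.trans_lt hn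
    have h4 := lt_of_mul_lt_mul_left h3 (by positivity)
    linarith⟩ (by rw [add_mul, he.isIdempotentElem.eq, hde, add_zero])
  linarith

/-- In a diffuse summand there are arbitrarily many trace-orthogonal self-adjoint unitaries. -/
theorem exists_orthogonal_unitaries (n : ℕ) {q : A} (hq : IsStarProjection q) (hpq : p * q = q) :
    ∃ u : Fin n → A, (∀ i, IsSelfAdjoint (u i)) ∧ (∀ i, u i * u i = q) ∧ (∀ i, q * u i = u i) ∧
      (∀ i, τ (u i) = 0) ∧ ∀ i j, i ≠ j → τ (u i * u j) = 0 := by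
  induction n generalizing q with
  | zero => exact ⟨Fin.elim0, fun i => i.elim0, fun i => i.elim0, fun i => i.elim0,
      fun i => i.elim0, fun i => i.elim0⟩
  | succ n ih =>
    obtain ⟨r, hr, hqr, hhalf⟩ := h.exists_half hp hdiff hq hpq
    obtain ⟨s, hs_def⟩ : ∃ s, s = q - r := ⟨_, rfl⟩
    have hs : IsStarProjection s := hs_def ▸ isStarProjection_sub hq hr hqr
    have hrq := star_projection_mul_comm hq hr hqr
    have hqs : q * s = s := by rw [hs_def, mul_sub, hq.isIdempotentElem.eq, hqr]
    have hrs : r * s = 0 := by rw [hs_def, mul_sub, hrq, hr.isIdempotentElem.eq, sub_self]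
    have hsr : s * r = 0 := by rw [hs_def, sub_mul, hqr, hr.isIdempotentElem.eq, sub_self]
    have hrsq : r + s = q := by rw [hs_def]; abel
    have hτ : τ r = τ s := by
      rw [hs_def, map_sub, τ.apply_projection hr, τ.apply_projection hq, ← hhalf]
      push_cast
      ring
    obtain ⟨a, ha1, ha2, ha3, ha4, ha5⟩ := ih hr (by rw [← hqr, ← mul_assoc, hpq])
    obtain ⟨b, hb1, hb2, hb3, hb4, hb5⟩ := ih hs (by rw [← hqs, ← mul_assoc, hpq])
    have ha3' : ∀ i, a i * r = a i := fun i => by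
      have := congrArg star (ha3 i)
      rwa [star_mul, (ha1 i).star_eq, hr.isSelfAdjoint.star_eq] at this
    have hb3' : ∀ i, b i * s = b i := fun i => by
      have := congrArg star (hb3 i)
      rwa [star_mul, (hb1 i).star_eq, hs.isSelfAdjoint.star_eq] at this
    have hab : ∀ i j, a i * b j = 0 := fun i j => by
      rw [← ha3' i, ← hb3 j, mul_assoc, ← mul_assoc r, hrs, zero_mul, mul_zero]
    have hba : ∀ i j, b i * a j = 0 := fun i j => by
      rw [← hb3' i, ← ha3 j, mul_assoc, ← mul_assoc s, hsr, zero_mul, mul_zero]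
    have has : ∀ i, a i * s = 0 := fun i => by rw [← ha3' i, mul_assoc, hrs, mul_zero]
    have hbr : ∀ i, b i * r = 0 := fun i => by rw [← hb3' i, mul_assoc, hsr, mul_zero]
    have hqa : ∀ i, q * a i = a i := fun i => by rw [← ha3 i, ← mul_assoc, hqr]
    have hqb : ∀ i, q * b i = b i := fun i => by rw [← hb3 i, ← mul_assoc, hqs]
    -- Rademacher functions: the new unitary is `1` on one half and `-1` on the other, and the old
    -- ones are copied to both halves. The halves have equal trace, so all mixed traces vanish.
    refine ⟨Fin.cons (r - s) fun i => a i + b i, ?_, ?_, ?_, ?_, ?_⟩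
    · refine Fin.cases ?_ fun i => ?_
      · exact hr.isSelfAdjoint.sub hs.isSelfAdjoint
      · exact (ha1 i).add (hb1 i)
    · refine Fin.cases ?_ fun i => ?_
      · simp [mul_sub, sub_mul, hrs, hsr, hr.isIdempotentElem.eq, hs.isIdempotentElem.eq, hrsq]
      · simp [mul_add, add_mul, hab, hba, ha2, hb2, hrsq]
    · refine Fin.cases ?_ fun i => ?_
      · simp [mul_sub, hqr, hqs]
      · simp [mul_add, hqa, hqb]
    · refine Fin.cases ?_ fun i => ?_
      · simp [hτ]
      · simp [ha4, hb4]
    · have h0 : ∀ i, τ ((a i + b i) * (r - s)) = 0 := fun i => by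
        simp [mul_sub, add_mul, ha3', hb3', has, hbr, ha4, hb4]
      refine Fin.cases (Fin.cases ?_ fun j _ => ?_) fun i => Fin.cases (fun _ => ?_) fun j hij => ?_
      · simp
      · simpa [τ.tracial (r - s)] using h0 j
      · simpa using h0 i
      · have hij' : i ≠ j := fun hh => hij (by rw [hh])
        simp [mul_add, add_mul, hab, hba, ha5 i j hij', hb5 i j hij']

/-- In a diffuse summand the unit ball contains arbitrarily large uniformly separated sets. -/
theorem exists_separated (ι : Type*) [Fintype ι] :
    ∃ u : ι → A, (∀ i, IsSelfAdjoint (u i)) ∧ (∀ i, τ.OpBound 1 (u i)) ∧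
      ∀ i j, i ≠ j → τ.norm2 p ≤ τ.norm2 (u i - u j) := by
  obtain ⟨u, h1, h2, -, -, h5⟩ := h.exists_orthogonal_unitaries hp hdiff (Fintype.card ι) hp
    hp.isIdempotentElem.eq
  let e := Fintype.equivFin ι
  refine ⟨fun i => u (e i), fun i => h1 _, fun i => ?_, fun i j hij => ?_⟩
  · refine opBound_of_star_mul_self_projection ?_
    rwa [(h1 _).star_eq, h2]
  -- The squared distance is exactly `2 τ(p)`; the bound by `τ(p) = ‖p‖₂²` is enough.
  · refine (pow_le_pow_iff_left₀ (τ.norm2_nonneg _) (τ.norm2_nonneg _) two_ne_zero).1 ?_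
    have hne := e.injective.ne hij
    rw [norm2_sq_projection _ hp, norm2_sq, star_sub, (h1 _).star_eq, (h1 _).star_eq, sub_mul,
      mul_sub, mul_sub, map_sub, map_sub, map_sub, h5 _ _ hne, h5 _ _ hne.symm, h2, h2,
      ← norm2_sq_projection _ hp]
    simp only [sub_zero, zero_sub, Complex.sub_re, Complex.neg_re, ← norm2_sq_projection _ hp]
    have := sq_nonneg (τ.norm2 p)
    linarith

end Diffuse

end IsCompleteTracial
end TracialState

/-- A type I central summand of `A`: a system `v i * star (v j)` of matrix units whose diagonal
projections have one-dimensional corners and whose unit `∑ i, v i * star (v i)` is central. -/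
structure MatrixBlock (A : Type u) [Ring A] [StarRing A] [Algebra ℂ A] where
  q : A
  dim : ℕ
  dim_ne_zero : dim ≠ 0
  v : Fin dim → A
  isStarProjection_q : IsStarProjection q
  q_ne_zero : q ≠ 0
  corner : ∀ x, ∃ c : ℂ, q * x * q = c • q
  star_mul_v : ∀ i j, star (v i) * v j = if i = j then q else 0
  v_mul_q : ∀ i, v i * q = v i
  unit_comm : ∀ a, (∑ i, v i * star (v i)) * a = a * ∑ i, v i * star (v i)

/-! ### Matrix blocks generated by minimal projections -/

namespace TracialState

variable {A : Type u} [Ring A] [StarRing A] [Algebra ℂ A] [StarModule ℂ A] {τ : TracialState A}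

section PartialIsometries

variable {q : A} {d : ℕ} {v : Fin d → A}

theorem q_mul_star_v (hq : IsStarProjection q) (hvq : ∀ i, v i * q = v i) (i : Fin d) :
    q * star (v i) = star (v i) := by
  conv_rhs => rw [← hvq i, star_mul, hq.isSelfAdjoint.star_eq]

theorem unit_mul_v (hv : ∀ i j, star (v i) * v j = if i = j then q else 0)
    (hvq : ∀ i, v i * q = v i) (j : Fin d) : (∑ i, v i * star (v i)) * v j = v j := by
  simp [Finset.sum_mul, mul_assoc, hv, hvq]

theorem isSelfAdjoint_unit (v : Fin d → A) : IsSelfAdjoint (∑ i, v i * star (v i)) := by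
  simp [IsSelfAdjoint]

theorem star_v_mul_unit (hv : ∀ i j, star (v i) * v j = if i = j then q else 0)
    (hvq : ∀ i, v i * q = v i) (j : Fin d) :
    star (v j) * (∑ i, v i * star (v i)) = star (v j) := by
  have := congrArg star (unit_mul_v hv hvq j)
  rwa [star_mul, (isSelfAdjoint_unit v).star_eq] at this

theorem isStarProjection_unit (hv : ∀ i j, star (v i) * v j = if i = j then q else 0)
    (hvq : ∀ i, v i * q = v i) : IsStarProjection (∑ i, v i * star (v i)) := by
  refine ⟨?_, isSelfAdjoint_unit v⟩
  rw [IsIdempotentElem]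
  conv_lhs => rw [Finset.mul_sum]
  refine Finset.sum_congr rfl fun i _ => ?_
  rw [← mul_assoc, unit_mul_v hv hvq]

end PartialIsometries

namespace IsCompleteTracial

variable (h : τ.IsCompleteTracial)
include h

/-- Every minimal projection generates a matrix block. -/
theorem exists_matrixBlock {q : A} (hq : IsMinimalProjection q) :
    ∃ b : MatrixBlock A, b.q = q := by
  have hqp := hq.1
  have hqq := hqp.isIdempotentElem.eq
  have hqs := hqp.isSelfAdjoint.star_eq
  have hqpos : 0 < τ.norm2 q ^ 2 := pow_pos (h.norm2_pos hq.2.1) 2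
  -- `Q d` means that `d` orthogonal copies of `q` fit into `1`. Traces force `d τ(q) ≤ 1`, so there
  -- is a `d` that cannot be increased.
  let Q : ℕ → Prop := fun d => ∃ v : Fin d → A,
    (∀ i j, star (v i) * v j = if i = j then q else 0) ∧ ∀ i, v i * q = v i
  have hQ1 : Q 1 := ⟨fun _ => q, fun i j => by simp [Subsingleton.elim i j, hqs, hqq],
    fun _ => hqq⟩
  have hbound : ∀ d, Q d → d * τ.norm2 q ^ 2 ≤ 1 := by
    rintro d ⟨v, hv, hvq⟩
    have h1 := norm2_projection_le_one (τ := τ) (isStarProjection_unit hv hvq)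
    have h2 := norm2_sq_projection τ (isStarProjection_unit hv hvq)
    rw [map_sum, Finset.sum_congr rfl fun i _ => (τ.tracial (v i) (star (v i))).trans
      (congrArg τ (hv i i))] at h2
    simp only [if_true, Finset.sum_const, Finset.card_univ, Fintype.card_fin, nsmul_eq_mul,
      τ.apply_projection hqp, ← Complex.ofReal_natCast, Complex.re_ofReal_mul,
      Complex.ofReal_re] at h2
    rw [← h2]
    exact pow_le_one₀ (τ.norm2_nonneg _) h1
  obtain ⟨d, hd, hd1⟩ : ∃ d, Q d ∧ ¬ Q (d + 1) := by
    by_contra! hc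
    have hall : ∀ d, Q (d + 1) := fun d => by
      induction d with
      | zero => exact hQ1
      | succ d ih => exact hc _ ih
    obtain ⟨n, hn⟩ := exists_nat_gt (1 / τ.norm2 q ^ 2)
    rw [div_lt_iff₀ hqpos] at hn
    have := hbound _ (hall n)
    push_cast at this
    linarith
  obtain ⟨v, hv, hvq⟩ := hd
  set z := ∑ i, v i * star (v i) with hz
  have hzp : IsStarProjection z := isStarProjection_unit hv hvq
  -- Otherwise `w = (1 - z) a q` satisfies `w⋆ w = r q` with a scalar `r > 0`, since the corner is
  -- scalar. Then `w / √r` is one more partial isometry with source `q` and range orthogonal to `z`,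
  -- contradicting the choice of `d`.
  have hkey : ∀ a, (1 - z) * a * q = 0 := by
    intro a
    by_contra hw0
    set w := (1 - z) * a * q with hw
    obtain ⟨c, hc⟩ := h.corner_scalar hq (star a * (1 - z) * a)
    have hww : star w * w = c • q := by
      rw [← hc, hw, star_mul, star_mul, hqs, hzp.one_sub.isSelfAdjoint.star_eq]
      have := hzp.one_sub.isIdempotentElem.eq
      calc q * (star a * (1 - z)) * ((1 - z) * a * q)
          = q * (star a * ((1 - z) * (1 - z)) * a) * q := by simp only [mul_assoc]
        _ = _ := by rw [this]
    have hcr : c = ((τ.norm2 w ^ 2 / τ.norm2 q ^ 2 : ℝ) : ℂ) := by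
      have h1 := congrArg τ hww
      rw [apply_star_mul_self, map_smul, smul_eq_mul, τ.apply_projection hqp] at h1
      rw [Complex.ofReal_div, h1, mul_div_cancel_right₀]
      exact_mod_cast hqpos.ne'
    set r : ℝ := τ.norm2 w ^ 2 / τ.norm2 q ^ 2 with hr
    have hrpos : 0 < r := div_pos (pow_pos (h.norm2_pos hw0) 2) hqpos
    have hvw : ∀ i, star (v i) * w = 0 := fun i => by
      rw [hw, ← mul_assoc, ← mul_assoc, mul_sub, mul_one, star_v_mul_unit hv hvq, sub_self,
        zero_mul, zero_mul]
    have hwv : ∀ i, star w * v i = 0 := fun i => by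
      have := congrArg star (hvw i)
      rwa [star_mul, star_star, star_zero] at this
    set s : ℂ := (((√r)⁻¹ : ℝ) : ℂ) with hs
    have hss : star s * s * c = 1 := by
      rw [hs, hcr, Complex.star_def, Complex.conj_ofReal, ← Complex.ofReal_mul,
        ← Complex.ofReal_mul, ← mul_inv, Real.mul_self_sqrt hrpos.le, inv_mul_cancel₀ hrpos.ne',
        Complex.ofReal_one]
    refine hd1 ⟨Fin.cons (s • w) v, ?_, ?_⟩
    · refine Fin.cases (Fin.cases ?_ fun j => ?_) fun i => Fin.cases ?_ fun j => ?_
      · rw [if_pos rfl, Fin.cons_zero, star_smul, smul_mul_smul_comm, hww, smul_smul, hss, one_smul]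
      · rw [if_neg (Fin.succ_ne_zero j).symm, Fin.cons_zero, Fin.cons_succ, star_smul,
          smul_mul_assoc, hwv, smul_zero]
      · rw [if_neg (Fin.succ_ne_zero i), Fin.cons_zero, Fin.cons_succ, mul_smul_comm, hvw,
          smul_zero]
      · simp [hv]
    · refine Fin.cases ?_ fun i => ?_
      · rw [Fin.cons_zero, smul_mul_assoc, hw, mul_assoc, hqq]
      · exact hvq i
  -- Every summand of `z` factors through `q`, so `hkey` gives `(1 - z) a z = 0`. Comparison with
  -- the adjoint relation makes `z` central.
  have hzaz : ∀ a, a * z = z * a * z := by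
    intro a
    have : (1 - z) * a * z = 0 := by
      rw [hz, Finset.mul_sum]
      refine Finset.sum_eq_zero fun i _ => ?_
      rw [← hvq i, star_mul, hqs]
      calc (1 - z) * a * (v i * q * (q * star (v i)))
          = ((1 - z) * (a * v i) * q) * (q * star (v i)) := by simp only [mul_assoc]
        _ = 0 := by rw [hkey, zero_mul]
    rwa [sub_mul, sub_mul, one_mul, sub_eq_zero] at this
  refine ⟨⟨q, d, ?_, v, hqp, hq.2.1, h.corner_scalar hq, hv, hvq, fun a => ?_⟩, rfl⟩
  · rintro rfl
    exact hd1 hQ1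
  · rw [← hz, hzaz a]
    have := congrArg star (hzaz (star a))
    simpa only [star_mul, star_star, hzp.isSelfAdjoint.star_eq, mul_assoc] using this

end IsCompleteTracial

end TracialState

/-! ### The matrix algebra carried by a block -/

namespace MatrixBlock

open TracialState

variable {A : Type u} [Ring A] [StarRing A] [Algebra ℂ A] [StarModule ℂ A] (b : MatrixBlock A)

instance : NeZero b.dim := ⟨b.dim_ne_zero⟩

/-- The central unit of a matrix block. -/
def unit : A := ∑ i, b.v i * star (b.v i)

theorem isStarProjection_unit : IsStarProjection b.unit :=
  TracialState.isStarProjection_unit b.star_mul_v b.v_mul_q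

theorem unit_comm' (a : A) : b.unit * a = a * b.unit := b.unit_comm a

theorem unit_mul_v (i : Fin b.dim) : b.unit * b.v i = b.v i :=
  TracialState.unit_mul_v b.star_mul_v b.v_mul_q i

theorem star_v_mul_unit (i : Fin b.dim) : star (b.v i) * b.unit = star (b.v i) :=
  TracialState.star_v_mul_unit b.star_mul_v b.v_mul_q i

theorem q_mul_star_v (i : Fin b.dim) : b.q * star (b.v i) = star (b.v i) :=
  TracialState.q_mul_star_v b.isStarProjection_q b.v_mul_q i

theorem exists_entry (x : A) (i j : Fin b.dim) : ∃ c : ℂ, star (b.v i) * x * b.v j = c • b.q := by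
  obtain ⟨c, hc⟩ := b.corner (star (b.v i) * x * b.v j)
  refine ⟨c, ?_⟩
  rw [← hc]
  conv_lhs => rw [← b.q_mul_star_v i, ← b.v_mul_q j]
  simp only [mul_assoc]

theorem smul_q_injective {c d : ℂ} (hcd : c • b.q = d • b.q) : c = d := by
  rw [← sub_eq_zero, ← sub_smul] at hcd
  by_contra hne
  exact b.q_ne_zero ((smul_eq_zero_iff_right (sub_ne_zero.2 hne)).1 hcd)

/-- The entries of `x` with respect to the matrix units of `b`. -/
noncomputable def entry (x : A) (i j : Fin b.dim) : ℂ := (b.exists_entry x i j).choose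

theorem entry_spec (x : A) (i j : Fin b.dim) :
    star (b.v i) * x * b.v j = b.entry x i j • b.q := (b.exists_entry x i j).choose_spec

theorem entry_eq {x : A} {i j : Fin b.dim} {c : ℂ} (hc : star (b.v i) * x * b.v j = c • b.q) :
    b.entry x i j = c :=
  b.smul_q_injective ((b.entry_spec x i j).symm.trans hc)

/-- The unit of the block is absorbed by `star (b.v i)` and is central, so it can be moved between
`x` and `y` and expanded there. -/
theorem entry_mul (x y : A) (i j : Fin b.dim) :
    b.entry (x * y) i j = ∑ k, b.entry x i k * b.entry y k j := by
  apply b.entry_eq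
  have hqq := b.isStarProjection_q.isIdempotentElem.eq
  calc star (b.v i) * (x * y) * b.v j = star (b.v i) * b.unit * (x * y) * b.v j := by
        rw [b.star_v_mul_unit]
    _ = star (b.v i) * x * b.unit * (y * b.v j) := by
        rw [mul_assoc (star (b.v i)), b.unit_comm']
        simp only [mul_assoc]
        rw [← mul_assoc y, ← b.unit_comm' y, mul_assoc]
    _ = ∑ k, (star (b.v i) * x * b.v k) * (star (b.v k) * y * b.v j) := by
        rw [unit, Finset.mul_sum, Finset.sum_mul]
        simp only [mul_assoc]
    _ = _ := by
        rw [Finset.sum_smul]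
        refine Finset.sum_congr rfl fun k _ => ?_
        rw [b.entry_spec, b.entry_spec, smul_mul_smul_comm, hqq]

/-- The representation of `A` on the matrix block `b`. -/
noncomputable def toMatrix : A →⋆ₐ[ℂ] Matrix (Fin b.dim) (Fin b.dim) ℂ where
  toFun x := Matrix.of (b.entry x)
  map_one' := by
    ext i j
    refine b.entry_eq ?_
    rw [mul_one, b.star_mul_v, Matrix.one_apply]
    split_ifs <;> simp
  map_mul' x y := by
    ext i j
    simp [Matrix.mul_apply, entry_mul]
  map_zero' := by
    ext i j
    exact b.entry_eq (by simp)
  map_add' x y := by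
    ext i j
    refine b.entry_eq ?_
    simp [mul_add, add_mul, entry_spec, add_smul]
  commutes' r := by
    ext i j
    refine b.entry_eq ?_
    rw [Algebra.algebraMap_eq_smul_one, mul_smul_comm, smul_mul_assoc, mul_one, b.star_mul_v,
      Matrix.algebraMap_matrix_apply]
    split_ifs <;> simp
  map_star' x := by
    ext i j
    refine b.entry_eq ?_
    have := congrArg star (b.entry_spec x j i)
    rw [star_smul, b.isStarProjection_q.isSelfAdjoint.star_eq, star_mul, star_mul, star_star,
      ← mul_assoc] at this
    exact this

theorem toMatrix_apply (x : A) (i j : Fin b.dim) : b.toMatrix x i j = b.entry x i j := rfl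

/-- The element of `A` with prescribed matrix entries. -/
noncomputable def ofMatrix (a : Matrix (Fin b.dim) (Fin b.dim) ℂ) : A :=
  ∑ i, ∑ j, a i j • (b.v i * star (b.v j))

theorem toMatrix_ofMatrix (a : Matrix (Fin b.dim) (Fin b.dim) ℂ) :
    b.toMatrix (b.ofMatrix a) = a := by
  ext i j
  refine b.entry_eq ?_
  have hqq := b.isStarProjection_q.isIdempotentElem.eq
  have : ∀ k l, star (b.v i) * (a k l • (b.v k * star (b.v l))) * b.v j =
      if l = j then if i = k then a k l • b.q else 0 else 0 := by
    intro k l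
    rw [mul_smul_comm, smul_mul_assoc, ← mul_assoc, mul_assoc, b.star_mul_v, b.star_mul_v]
    split_ifs <;> simp [hqq]
  simp only [ofMatrix, Finset.mul_sum, Finset.sum_mul, this]
  simp

/-- The representation therefore loses exactly the part of `x` outside the block, and `ofMatrix`
identifies the matrices with the summand `b.unit * A`. -/
theorem ofMatrix_toMatrix (x : A) : b.ofMatrix (b.toMatrix x) = b.unit * x := by
  have : ∀ i j, b.toMatrix x i j • (b.v i * star (b.v j)) =
      b.v i * star (b.v i) * x * (b.v j * star (b.v j)) := by
    intro i j
    have h2 : b.v i * star (b.v i) * x * (b.v j * star (b.v j)) =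
        b.v i * (star (b.v i) * x * b.v j) * star (b.v j) := by simp only [mul_assoc]
    rw [h2, b.entry_spec, mul_smul_comm, b.v_mul_q, smul_mul_assoc]
    rfl
  simp only [ofMatrix, this]
  simp only [← Finset.mul_sum, ← Finset.sum_mul]
  change b.unit * x * b.unit = _
  rw [mul_assoc, ← b.unit_comm', ← mul_assoc, b.isStarProjection_unit.isIdempotentElem.eq]

theorem unit_mul_ofMatrix (a : Matrix (Fin b.dim) (Fin b.dim) ℂ) :
    b.unit * b.ofMatrix a = b.ofMatrix a := by
  rw [← b.ofMatrix_toMatrix, b.toMatrix_ofMatrix]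

theorem toMatrix_unit : b.toMatrix b.unit = 1 := by
  ext i j
  refine b.entry_eq ?_
  rw [b.star_v_mul_unit, b.star_mul_v, Matrix.one_apply]
  split_ifs <;> simp

theorem unit_mul_eq_of_toMatrix_eq {x y : A} (hxy : b.toMatrix x = b.toMatrix y) :
    b.unit * x = b.unit * y := by
  rw [← b.ofMatrix_toMatrix, hxy, b.ofMatrix_toMatrix]

theorem unit_ne_zero : b.unit ≠ 0 := by
  intro h0
  have := b.toMatrix_unit
  rw [h0, map_zero] at this
  exact zero_ne_one this

/-- The units of two blocks are equal or orthogonal. -/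
theorem unit_eq_or_mul_eq_zero (c : MatrixBlock A) : b.unit = c.unit ∨ b.unit * c.unit = 0 := by
  have key : ∀ b c : MatrixBlock A, b.unit * c.unit = 0 ∨ b.unit * c.unit = b.unit := by
    intro b c
    -- Since `c.unit` is central, cutting `b.q` by it gives a multiple `r • b.q` with `r² = r`. The
    -- same scalar governs all of `b.unit`, so `c.unit` either misses it or contains it.
    obtain ⟨r, hr⟩ := b.corner c.unit
    have hqq := b.isStarProjection_q.isIdempotentElem.eq
    have hcc := c.isStarProjection_unit.isIdempotentElem.eq
    rw [← c.unit_comm', mul_assoc, hqq] at hr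
    have hr2 : r * r = r := by
      apply b.smul_q_injective
      have h1 : c.unit * (c.unit * b.q) = r • (r • b.q) := by rw [hr, mul_smul_comm, hr]
      rw [← mul_assoc, hcc, hr, smul_smul] at h1
      exact h1.symm
    have hexp : b.unit * c.unit = r • b.unit := by
      rw [unit, Finset.sum_mul, Finset.smul_sum]
      refine Finset.sum_congr rfl fun i _ => ?_
      rw [mul_assoc, ← c.unit_comm', ← b.q_mul_star_v i, ← mul_assoc c.unit, hr, smul_mul_assoc,
        b.q_mul_star_v, mul_smul_comm]
    rcases mul_eq_zero.1 (show r * (r - 1) = 0 by rw [mul_sub, mul_one, hr2, sub_self])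
      with h0 | h1
    · left; rw [hexp, h0, zero_smul]
    · right; rw [hexp, sub_eq_zero.1 h1, one_smul]
  rcases key b c with h1 | h1
  · exact .inr h1
  · rcases key c b with h2 | h2
    · right; rw [b.unit_comm', h2]
    · left; rw [← h1, b.unit_comm', h2]

end MatrixBlock

namespace MatrixBlock

open TracialState

variable {A : Type u} [Ring A] [StarRing A] [Algebra ℂ A] [StarModule ℂ A] (b : MatrixBlock A)

theorem ofMatrix_mul (a c : Matrix (Fin b.dim) (Fin b.dim) ℂ) :
    b.ofMatrix (a * c) = b.ofMatrix a * b.ofMatrix c := by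
  conv_lhs => rw [← b.toMatrix_ofMatrix a, ← b.toMatrix_ofMatrix c, ← map_mul,
    b.ofMatrix_toMatrix, ← mul_assoc, b.unit_mul_ofMatrix]

theorem ofMatrix_star (a : Matrix (Fin b.dim) (Fin b.dim) ℂ) :
    b.ofMatrix (star a) = star (b.ofMatrix a) := by
  conv_lhs => rw [← b.toMatrix_ofMatrix a, ← StarHomClass.map_star, b.ofMatrix_toMatrix]
  rw [b.unit_comm', ← b.isStarProjection_unit.isSelfAdjoint.star_eq, ← star_mul,
    b.unit_mul_ofMatrix]

theorem ofMatrix_add (a c : Matrix (Fin b.dim) (Fin b.dim) ℂ) :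
    b.ofMatrix (a + c) = b.ofMatrix a + b.ofMatrix c := by
  simp [ofMatrix, add_smul, Finset.sum_add_distrib]

theorem ofMatrix_smul_one (r : ℂ) : b.ofMatrix (r • 1) = r • b.unit := by
  rw [← b.toMatrix_unit, ← map_smul, b.ofMatrix_toMatrix, mul_smul_comm,
    b.isStarProjection_unit.isIdempotentElem.eq]

section Norm

open scoped Matrix.Norms.L2Operator

variable {τ : TracialState A}

theorem norm2_sq_projection_mul {z : A} (hz : IsStarProjection z) (x : A) :
    τ.norm2 (z * x) ^ 2 = (τ (star x * z * x)).re := by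
  rw [norm2_mul_sq, hz.isSelfAdjoint.star_eq, hz.isIdempotentElem.eq]

/-- In the matrix algebra, `C² - a⋆ a` is of the form `w⋆ w`; `ofMatrix` carries this identity into
`A`, with `C²` becoming a multiple of the block unit. -/
theorem norm2_ofMatrix_mul_sq_le {a : Matrix (Fin b.dim) (Fin b.dim) ℂ} {C : ℝ} (hC : ‖a‖ ≤ C)
    (x : A) : τ.norm2 (b.ofMatrix a * x) ^ 2 ≤ C ^ 2 * τ.norm2 (b.unit * x) ^ 2 := by
  let _ := CStarAlgebra.spectralOrder (Matrix (Fin b.dim) (Fin b.dim) ℂ)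
  have := CStarAlgebra.spectralOrderedRing (Matrix (Fin b.dim) (Fin b.dim) ℂ)
  have h1 : star a * a ≤ algebraMap ℝ _ (C ^ 2) := by
    refine (IsSelfAdjoint.star_mul_self a).le_algebraMap_norm_self.trans ?_
    rw [CStarRing.norm_star_mul_self]
    exact algebraMap_mono _ (by nlinarith [norm_nonneg a])
  obtain ⟨w, hw⟩ := CStarAlgebra.nonneg_iff_eq_star_mul_self.1 (sub_nonneg.2 h1)
  rw [norm2_sq_projection_mul b.isStarProjection_unit]
  refine norm2_mul_sq_le_of_add_eq (w := b.ofMatrix w) ?_ x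
  rw [← b.ofMatrix_star, ← b.ofMatrix_star, ← b.ofMatrix_mul, ← b.ofMatrix_mul,
    ← b.ofMatrix_add, ← hw, ← b.ofMatrix_smul_one]
  congr 1
  rw [add_sub_cancel, Algebra.algebraMap_eq_smul_one, Complex.coe_smul]

/-- The `v j` are orthogonal in `L²` with common norm `‖q‖₂`, so their span is a scaled copy of the
Euclidean space on which the matrices act. -/
theorem norm2_sq_sum_smul_v (ξ : EuclideanSpace ℂ (Fin b.dim)) :
    τ.norm2 (∑ j, ξ j • b.v j) ^ 2 = ‖ξ‖ ^ 2 * τ.norm2 b.q ^ 2 := by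
  have h1 : star (∑ j, ξ j • b.v j) * (∑ j, ξ j • b.v j) = ((‖ξ‖ ^ 2 : ℝ) : ℂ) • b.q := by
    rw [EuclideanSpace.norm_sq_eq, star_sum, Finset.sum_mul]
    push_cast
    rw [Finset.sum_smul]
    refine Finset.sum_congr rfl fun i _ => ?_
    rw [Finset.mul_sum, Finset.sum_eq_single i]
    · rw [star_smul, smul_mul_smul_comm, b.star_mul_v, if_pos rfl, Complex.star_def,
        Complex.conj_mul']
    · intro j _ hj
      rw [star_smul, smul_mul_smul_comm, b.star_mul_v, if_neg hj.symm, smul_zero]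
    · simp
  rw [norm2_sq, h1, map_smul, smul_eq_mul, Complex.re_ofReal_mul,
    ← norm2_sq_projection _ b.isStarProjection_q]

/-- On the span of the `v j`, left multiplication by `x` followed by the block unit acts as the
matrix of `x`. The common factor `‖q‖₂` cancels from the estimate. -/
theorem norm_toMatrix_le (h : τ.IsCompleteTracial) {x : A} {C : ℝ} (hC : 0 ≤ C)
    (hx : τ.OpBound C x) : ‖b.toMatrix x‖ ≤ C := by
  rw [Matrix.cstar_norm_def]
  refine ContinuousLinearMap.opNorm_le_bound _ hC fun ξ => ?_
  set η : EuclideanSpace ℂ (Fin b.dim) :=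
    Matrix.toEuclideanCLM (n := Fin b.dim) (𝕜 := ℂ) (b.toMatrix x) ξ with hη
  have hηi : ∀ i, η i = ∑ j, b.entry x i j * ξ j := by
    intro i
    rw [hη, Matrix.ofLp_toEuclideanCLM]
    simp [Matrix.mulVec, dotProduct, toMatrix_apply]
  have h1 : b.unit * (x * ∑ j, ξ j • b.v j) = ∑ i, η i • b.v i := by
    rw [unit, Finset.sum_mul]
    refine Finset.sum_congr rfl fun i _ => ?_
    have h2 : star (b.v i) * (x * ∑ j, ξ j • b.v j) = η i • b.q := by
      rw [hηi, Finset.sum_smul, ← mul_assoc, Finset.mul_sum]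
      refine Finset.sum_congr rfl fun j _ => ?_
      rw [mul_smul_comm, b.entry_spec, smul_smul, mul_comm]
    rw [mul_assoc, h2, mul_smul_comm, b.v_mul_q]
  have h3 : τ.norm2 (∑ i, η i • b.v i) ≤ C * τ.norm2 (∑ j, ξ j • b.v j) := by
    rw [← h1]
    refine le_trans ?_ (hx _)
    simpa using opBound_of_projection (τ := τ) b.isStarProjection_unit (x * ∑ j, ξ j • b.v j)
  have h4 := pow_le_pow_left₀ (τ.norm2_nonneg _) h3 2
  rw [mul_pow, norm2_sq_sum_smul_v, norm2_sq_sum_smul_v, ← mul_assoc] at h4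
  have h5 := le_of_mul_le_mul_right h4 (pow_pos (h.norm2_pos b.q_ne_zero) 2)
  exact (pow_le_pow_iff_left₀ (norm_nonneg _) (by positivity) two_ne_zero).1 (by rwa [mul_pow])

end Norm

end MatrixBlock

/-! ### Orthogonal series and the enumeration of blocks -/

namespace TracialState

variable {A : Type u} [Ring A] [StarRing A] [Algebra ℂ A] [StarModule ℂ A] {τ : TracialState A}

theorem norm2_sq_sum {ι : Type*} (t : Finset ι) {y : ι → A}
    (hy : ∀ i ∈ t, ∀ j ∈ t, i ≠ j → star (y i) * y j = 0) (x : A) :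
    τ.norm2 ((∑ i ∈ t, y i) * x) ^ 2 = ∑ i ∈ t, τ.norm2 (y i * x) ^ 2 := by
  have h1 : star (∑ i ∈ t, y i) * ∑ i ∈ t, y i = ∑ i ∈ t, star (y i) * y i := by
    rw [star_sum, Finset.sum_mul]
    refine Finset.sum_congr rfl fun i hi => ?_
    rw [Finset.mul_sum, Finset.sum_eq_single i]
    · intro j hj hji
      exact hy i hi j hj hji.symm
    · exact fun h => absurd hi h
  simp only [norm2_mul_sq]
  rw [h1, Finset.mul_sum, Finset.sum_mul, map_sum, Complex.re_sum]

theorem isStarProjection_sum {ι : Type*} (t : Finset ι) {z : ι → A}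
    (hz : ∀ i ∈ t, IsStarProjection (z i)) (hzz : ∀ i ∈ t, ∀ j ∈ t, i ≠ j → z i * z j = 0) :
    IsStarProjection (∑ i ∈ t, z i) := by
  refine ⟨?_, ?_⟩
  · rw [IsIdempotentElem, Finset.sum_mul]
    refine Finset.sum_congr rfl fun i hi => ?_
    rw [Finset.mul_sum, Finset.sum_eq_single i]
    · exact (hz i hi).isIdempotentElem.eq
    · exact fun j hj hji => hzz i hi j hj hji.symm
    · exact fun h => absurd hi h
  · rw [IsSelfAdjoint, star_sum]
    exact Finset.sum_congr rfl fun i hi => (hz i hi).isSelfAdjoint.star_eq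

/-- Pairwise orthogonal nonzero projections form a countable set. -/
theorem IsCompleteTracial.countable_of_orthogonal (h : τ.IsCompleteTracial) {s : Set A}
    (hs : ∀ z ∈ s, IsStarProjection z) (hs0 : ∀ z ∈ s, z ≠ 0)
    (horth : ∀ z ∈ s, ∀ w ∈ s, z ≠ w → z * w = 0) : s.Countable := by
  have hsum : Summable fun z : s => τ.norm2 z.1 ^ 2 := by
    refine summable_of_sum_le (c := 1) (fun z => by positivity) fun t => ?_
    have h1 : ∀ i ∈ t, ∀ j ∈ t, i ≠ j → i.1 * j.1 = 0 := fun i _ j _ hij =>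
      horth i i.2 j j.2 (fun hh => hij (Subtype.ext hh))
    have h2 := norm2_sq_sum (τ := τ) t (y := fun z => z.1) (fun i hi j hj hij => by
      rw [(hs i i.2).isSelfAdjoint.star_eq, h1 i hi j hj hij]) 1
    simp only [mul_one] at h2
    rw [← h2]
    exact pow_le_one₀ (τ.norm2_nonneg _)
      (norm2_projection_le_one (isStarProjection_sum t (fun i _ => hs i i.2) h1))
  have := hsum.countable_support
  have hsupp : (Function.support fun z : s => τ.norm2 z.1 ^ 2) = Set.univ :=
    Set.eq_univ_of_forall fun z => (pow_pos (h.norm2_pos (hs0 z z.2)) 2).ne'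
  rw [hsupp] at this
  exact Set.countable_coe_iff.1 (Set.countable_univ_iff.1 this)

section OrthogonalSeries

variable {z : ℕ → A} (hz : ∀ n, IsStarProjection (z n)) (hzz : ∀ n m, n ≠ m → z n * z m = 0)
include hz hzz

theorem IsCompleteTracial.tendsto_sum_projections (h : τ.IsCompleteTracial) :
    ∃ e, IsStarProjection e ∧ τ.TendstoL2 (fun n => ∑ i ∈ Finset.range n, z i) e := by
  have hp : ∀ n, IsStarProjection (∑ i ∈ Finset.range n, z i) := fun n =>
    isStarProjection_sum _ (fun i _ => hz i) fun i _ j _ hij => hzz i j hij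
  obtain ⟨e, he, hlim, -⟩ := h.exists_tendsto_projection hp fun n => by
    have h1 : z n * ∑ i ∈ Finset.range n, z i = 0 := by
      rw [Finset.mul_sum]
      exact Finset.sum_eq_zero fun i hi => hzz n i (Finset.mem_range.1 hi).ne'
    rw [Finset.sum_range_succ, add_mul, (hp n).isIdempotentElem.eq, h1, add_zero]
  exact ⟨e, he, hlim⟩

/-- Convergence of a bounded orthogonal series. -/
theorem IsCompleteTracial.tendsto_sum (h : τ.IsCompleteTracial) {y : ℕ → A} {C : ℝ} (hC : 0 ≤ C)
    (hyz : ∀ n, z n * y n = y n)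
    (hy : ∀ n x, τ.norm2 (y n * x) ^ 2 ≤ C ^ 2 * τ.norm2 (z n * x) ^ 2) :
    ∃ s, τ.TendstoL2 (fun n => ∑ i ∈ Finset.range n, y i) s := by
  have hstar : ∀ n, star (y n) * z n = star (y n) := fun n => by
    have := congrArg star (hyz n)
    rwa [star_mul, (hz n).isSelfAdjoint.star_eq] at this
  have horth : ∀ i j, i ≠ j → star (y i) * y j = 0 := fun i j hij => by
    rw [← hstar i, ← hyz j, mul_assoc, ← mul_assoc (z i), hzz i j hij, zero_mul, mul_zero]
  -- Pythagoras on both sides compares any finite partial sum with the corresponding sum of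
  -- projections. This yields both the uniform bound and the Cauchy property.
  have hbd : ∀ (t : Finset ℕ) x, τ.norm2 ((∑ i ∈ t, y i) * x) ≤
      C * τ.norm2 ((∑ i ∈ t, z i) * x) := by
    intro t x
    refine (pow_le_pow_iff_left₀ (τ.norm2_nonneg _)
      (mul_nonneg hC (τ.norm2_nonneg _)) two_ne_zero).1 ?_
    rw [mul_pow, norm2_sq_sum t (fun i _ j _ => horth i j), norm2_sq_sum t (fun i _ j _ hij => by
      rw [(hz i).isSelfAdjoint.star_eq, hzz i j hij]), Finset.mul_sum]
    exact Finset.sum_le_sum fun i _ => hy i x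
  obtain ⟨e, -, hlim⟩ := h.tendsto_sum_projections hz hzz
  refine h.complete C _ (fun n x => (hbd _ x).trans ?_) fun ε hε => ?_
  · refine mul_le_mul_of_nonneg_left ?_ hC
    simpa using opBound_of_projection (τ := τ) (isStarProjection_sum (Finset.range n)
      (fun i _ => hz i) fun i _ j _ hij => hzz i j hij) x
  -- The factor `2` accounts for passing through the limit `e`, and `C + 1` instead of `C` keeps the
  -- denominator positive.
  · obtain ⟨N, hN⟩ := (Metric.tendsto_atTop.1 hlim) (ε / (2 * (C + 1))) (by positivity)
    have hdiff : ∀ (f : ℕ → A) m n, m ≤ n →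
        ∑ i ∈ Finset.range n, f i - ∑ i ∈ Finset.range m, f i = ∑ i ∈ Finset.Ico m n, f i :=
      fun f m n hmn => (Finset.sum_Ico_eq_sub f hmn).symm
    have key : ∀ m ≥ N, ∀ n ≥ m,
        τ.norm2 (∑ i ∈ Finset.range n, y i - ∑ i ∈ Finset.range m, y i) < ε := by
      intro m hm n hn
      have h1 := hN m hm
      have h2 := hN n (hm.trans hn)
      rw [Real.dist_eq, sub_zero, abs_of_nonneg (τ.norm2_nonneg _)] at h1 h2
      have h3 := hbd (Finset.Ico m n) 1
      rw [mul_one, mul_one, ← hdiff y m n hn, ← hdiff z m n hn] at h3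
      have h4 := τ.norm2_sub_le_norm2_sub_add (∑ i ∈ Finset.range n, z i) e
        (∑ i ∈ Finset.range m, z i)
      rw [τ.norm2_sub_rev e] at h4
      refine h3.trans_lt ?_
      have h5 : τ.norm2 (∑ i ∈ Finset.range n, z i - ∑ i ∈ Finset.range m, z i) < ε / (C + 1) := by
        have : ε / (C + 1) = ε / (2 * (C + 1)) + ε / (2 * (C + 1)) := by field_simp; ring
        linarith
      rw [lt_div_iff₀ (by linarith)] at h5
      nlinarith [τ.norm2_nonneg (∑ i ∈ Finset.range n, z i - ∑ i ∈ Finset.range m, z i)]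
    refine ⟨N, fun m hm n hn => ?_⟩
    rcases le_total m n with hmn | hmn
    · rw [norm2_sub_rev]; exact key m hm n hmn
    · exact key n hn m hmn

end OrthogonalSeries

namespace IsCompleteTracial

variable (h : τ.IsCompleteTracial)
include h

/-- A countable enumeration of all matrix blocks, up to equality of their units. -/
theorem exists_enumeration_blocks : ∃ (I : Set ℕ) (b : I → MatrixBlock A),
    (∀ i j, i ≠ j → (b i).unit * (b j).unit = 0) ∧
    ∀ c : MatrixBlock A, ∃ i, (b i).unit = c.unit := by
  have hc : (Set.range (MatrixBlock.unit : MatrixBlock A → A)).Countable := by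
    refine h.countable_of_orthogonal ?_ ?_ ?_
    · rintro _ ⟨b, rfl⟩; exact b.isStarProjection_unit
    · rintro _ ⟨b, rfl⟩; exact b.unit_ne_zero
    · rintro _ ⟨b, rfl⟩ _ ⟨c, rfl⟩ hne
      exact (b.unit_eq_or_mul_eq_zero c).resolve_left hne
  obtain ⟨f, hf⟩ := Set.countable_iff_exists_injective.1 hc
  have hex : ∀ i : Set.range f, ∃ b : MatrixBlock A, f ⟨b.unit, b, rfl⟩ = i := by
    rintro ⟨_, ⟨_, b, rfl⟩, rfl⟩
    exact ⟨b, rfl⟩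
  choose b hb using hex
  refine ⟨Set.range f, b, fun i j hij => ?_, fun c => ⟨⟨f ⟨c.unit, c, rfl⟩, _, rfl⟩, ?_⟩⟩
  · refine ((b i).unit_eq_or_mul_eq_zero (b j)).resolve_left fun hh => hij (Subtype.ext ?_)
    rw [← hb i, ← hb j]
    simp only [hh]
  · have := hf (hb ⟨f ⟨c.unit, c, rfl⟩, _, rfl⟩)
    exact congrArg Subtype.val this

end IsCompleteTracial

end TracialState

/-! ### The direct sum decomposition in the absence of a diffuse summand -/

namespace TracialState
namespace IsCompleteTracial

variable {A : Type u} [Ring A] [StarRing A] [Algebra ℂ A] [StarModule ℂ A] {τ : TracialState A}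

section Enumeration

variable (h : τ.IsCompleteTracial) {I : Set ℕ} {b : I → MatrixBlock A}
  (horth : ∀ i j, i ≠ j → (b i).unit * (b j).unit = 0)
include h horth

open scoped Classical in
-- The index set `I` may be finite or have gaps; padding with zeros outside `I` reduces to series
-- over `ℕ`.
theorem exists_tendsto_blocks {C : ℝ} (hC : 0 ≤ C) (y : I → A)
    (hyz : ∀ i, (b i).unit * y i = y i)
    (hy : ∀ i x, τ.norm2 (y i * x) ^ 2 ≤ C ^ 2 * τ.norm2 ((b i).unit * x) ^ 2) :
    ∃ s, τ.TendstoL2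
      (fun n => ∑ i ∈ Finset.range n, if hi : i ∈ I then y ⟨i, hi⟩ else 0) s := by
  refine h.tendsto_sum (z := fun i => if hi : i ∈ I then (b ⟨i, hi⟩).unit else 0)
    (fun n => ?_) (fun n m hnm => ?_) hC (fun n => ?_) (fun n x => ?_)
  · split_ifs
    · exact (b _).isStarProjection_unit
    · exact .zero A
  · split_ifs
    · exact horth _ _ fun hh => hnm (congrArg Subtype.val hh)
    all_goals simp
  · split_ifs
    · exact hyz _
    · simp
  · split_ifs
    · exact hy _ x
    · simp

open scoped Classical in
theorem unit_mul_limit {y : I → A} (hyz : ∀ i, (b i).unit * y i = y i) {s : A}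
    (hs : τ.TendstoL2 (fun n => ∑ i ∈ Finset.range n, if hi : i ∈ I then y ⟨i, hi⟩ else 0) s)
    (i : I) : (b i).unit * s = y i := by
  refine h.unique (h.mul_left hs (b i).unit) ((tendstoL2_const (y i)).congr ?_)
  filter_upwards [eventually_gt_atTop i.1] with n hn
  rw [Finset.mul_sum, Finset.sum_eq_single i.1]
  · rw [dif_pos i.2, hyz]
  · intro j _ hji
    split_ifs with hj
    · rw [← hyz ⟨j, hj⟩, ← mul_assoc, horth _ _ (fun hh => hji (congrArg Subtype.val hh).symm),
        zero_mul]
    · rw [mul_zero]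
  · exact fun hh => absurd (Finset.mem_range.2 hn) hh

open scoped Classical in
/-- Without a diffuse summand, the units of the blocks sum up to `1`. -/
theorem tendsto_units (hall : ∀ c : MatrixBlock A, ∃ i, (b i).unit = c.unit)
    (hdiff : ¬ HasDiffuseSummand A) :
    τ.TendstoL2
      (fun n => ∑ i ∈ Finset.range n, if hi : i ∈ I then (b ⟨i, hi⟩).unit else 0) 1 := by
  have hzz := fun i => (b i).isStarProjection_unit.isIdempotentElem.eq
  obtain ⟨e, he, hlim⟩ := h.tendsto_sum_projections
    (z := fun i => if hi : i ∈ I then (b ⟨i, hi⟩).unit else 0) (fun n => by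
      split_ifs
      · exact (b _).isStarProjection_unit
      · exact .zero A) (fun n m hnm => by
      split_ifs
      · exact horth _ _ fun hh => hnm (congrArg Subtype.val hh)
      all_goals simp)
  have hze : ∀ i, (b i).unit * e = (b i).unit := fun i =>
    h.unit_mul_limit horth (y := fun i => (b i).unit) hzz hlim i
  have hcomm : ∀ a, a * e = e * a := fun a => by
    refine h.unique (h.mul_left hlim a) ((h.mul_right hlim a).congr (.of_forall fun n => ?_))
    rw [Finset.mul_sum, Finset.sum_mul]
    refine Finset.sum_congr rfl fun i _ => ?_
    split_ifs
    · exact (b _).unit_comm' a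
    · simp
  suffices he1 : 1 - e = 0 by rwa [sub_eq_zero.1 he1]
  by_contra hne
  -- If `1 - e` were nonzero, it would be the unit of a diffuse summand: a minimal projection below
  -- it would generate a block whose unit lies below `e`, so this unit would annihilate its own
  -- generating projection and be zero.
  refine hdiff ⟨1 - e, he.one_sub, Semigroup.mem_center_iff.2 fun a => ?_, hne, fun q hq hpq => ?_⟩
  · rw [mul_sub, sub_mul, hcomm, mul_one, one_mul]
  · obtain ⟨c, hc⟩ := h.exists_matrixBlock hq
    obtain ⟨i, hi⟩ := hall c
    have hcu : c.unit * q = 0 := by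
      rw [← hpq, ← hi, ← mul_assoc, mul_sub, mul_one, hze, sub_self, zero_mul]
    refine c.unit_ne_zero ?_
    rw [← c.isStarProjection_unit.isIdempotentElem.eq]
    nth_rewrite 2 [MatrixBlock.unit]
    rw [Finset.mul_sum]
    refine Finset.sum_eq_zero fun k _ => ?_
    rw [← c.v_mul_q k, hc, mul_assoc, ← mul_assoc, c.unit_comm', mul_assoc, ← mul_assoc c.unit,
      hcu, zero_mul, mul_zero]

open scoped Matrix.Norms.L2Operator Classical in
-- Injectivity holds because the block units sum to `1`. Surjectivity is the convergence of the
-- orthogonal series assembled from a bounded family of matrices.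
theorem isDirectSum_of_enumeration (hall : ∀ c : MatrixBlock A, ∃ i, (b i).unit = c.unit)
    (hdiff : ¬ HasDiffuseSummand A) : IsDirectSumOfMatrixAlgebras A := by
  have hone := h.tendsto_units horth hall hdiff
  have hmem : ∀ x, Memℓp (fun i => (b i).toMatrix x) ∞ := fun x => by
    obtain ⟨C, hC, hx⟩ := h.bounded x
    refine memℓp_infty ⟨C, ?_⟩
    rintro _ ⟨i, rfl⟩
    exact (b i).norm_toMatrix_le h hC.le hx
  let Φ : A → lp (fun i => Matrix (Fin (b i).dim) (Fin (b i).dim) ℂ) ∞ :=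
    fun x => ⟨fun i => (b i).toMatrix x, hmem x⟩
  have hinj : Function.Injective Φ := by
    intro x y hxy
    have h1 : ∀ i, (b i).unit * x = (b i).unit * y := fun i =>
      (b i).unit_mul_eq_of_toMatrix_eq (congrFun (congrArg Subtype.val hxy) i)
    rw [← one_mul x, ← one_mul y]
    refine h.unique (h.mul_right hone x) ((h.mul_right hone y).congr (.of_forall fun n => ?_))
    rw [Finset.sum_mul, Finset.sum_mul]
    refine Finset.sum_congr rfl fun i _ => ?_
    split_ifs
    · exact (h1 _).symm
    · simp
  have hsurj : Function.Surjective Φ := by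
    intro a
    obtain ⟨s, hs⟩ := h.exists_tendsto_blocks horth (norm_nonneg a)
      (fun i => (b i).ofMatrix (a i)) (fun i => (b i).unit_mul_ofMatrix _)
      (fun i x => (b i).norm2_ofMatrix_mul_sq_le (lp.norm_apply_le_norm ENNReal.top_ne_zero a i) x)
    refine ⟨s, lp.ext (funext fun i => ?_)⟩
    have h1 := h.unit_mul_limit horth (fun i => (b i).unit_mul_ofMatrix _) hs i
    change (b i).toMatrix s = a i
    rw [← (b i).toMatrix_ofMatrix (a i), ← h1, map_mul, (b i).toMatrix_unit, one_mul]
  refine ⟨I, inferInstance, fun i => (b i).dim, fun i => inferInstance, ⟨?_⟩⟩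
  exact
    { Equiv.ofBijective Φ ⟨hinj, hsurj⟩ with
      map_mul' := fun x y => lp.ext (funext fun i => map_mul (b i).toMatrix x y)
      map_add' := fun x y => lp.ext (funext fun i => map_add (b i).toMatrix x y)
      map_star' := fun x => lp.ext (funext fun i => StarHomClass.map_star (b i).toMatrix x)
      map_smul' := fun c x => lp.ext (funext fun i => map_smul (b i).toMatrix c x) }

open scoped Classical in
-- The countably many matrix units span a dense subspace: truncating `x` to finitely many blocks
-- gives an element of the span, and the truncations converge to `x`.
theorem separable_of_enumeration (hall : ∀ c : MatrixBlock A, ∃ i, (b i).unit = c.unit)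
    (hdiff : ¬ HasDiffuseSummand A) : TopologicalSpace.SeparableSpace (L2 A τ) := by
  have hone := h.tendsto_units horth hall hdiff
  let _ : NormedSpace ℂ (L2 A τ) := ⟨fun c x => (τ.norm2_smul c x).le⟩
  let D : Set (L2 A τ) := ⋃ i : I, Set.range fun p : Fin (b i).dim × Fin (b i).dim =>
    (b i).v p.1 * star ((b i).v p.2)
  have hD : D.Countable := Set.countable_iUnion fun i => Set.countable_range _
  have hS := (hD.isSeparable.span (R := ℂ)).closure
  have hx : ∀ x : A, τ.TendstoL2 (fun n => (∑ i ∈ Finset.range n,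
      if hi : i ∈ I then (b ⟨i, hi⟩).unit else 0) * x) x := fun x => by
    simpa only [one_mul] using h.mul_right hone x
  have hspan : ∀ (x : A) (n : ℕ), (show L2 A τ from (∑ i ∈ Finset.range n,
      if hi : i ∈ I then (b ⟨i, hi⟩).unit else 0) * x) ∈ Submodule.span ℂ D := by
    intro x n
    have : (∑ i ∈ Finset.range n, if hi : i ∈ I then (b ⟨i, hi⟩).unit else 0) * x =
        ∑ i ∈ Finset.range n, if hi : i ∈ I then
          (b ⟨i, hi⟩).ofMatrix ((b ⟨i, hi⟩).toMatrix x) else 0 := by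
      rw [Finset.sum_mul]
      refine Finset.sum_congr rfl fun i _ => ?_
      split_ifs
      · rw [MatrixBlock.ofMatrix_toMatrix]
      · simp
    rw [this]
    refine Submodule.sum_mem (M := L2 A τ) _ fun i _ => ?_
    split_ifs with hi
    · refine Submodule.sum_mem (M := L2 A τ) _ fun k _ =>
        Submodule.sum_mem (M := L2 A τ) _ fun l _ =>
        Submodule.smul_mem (M := L2 A τ) _ _ (Submodule.subset_span ?_)
      exact Set.mem_iUnion.2 ⟨⟨i, hi⟩, (k, l), rfl⟩
    · exact Submodule.zero_mem (M := L2 A τ) _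
  have huniv : closure (Submodule.span ℂ D : Set (L2 A τ)) = Set.univ :=
    Set.eq_univ_of_forall fun x => mem_closure_of_tendsto
      (tendsto_iff_norm_sub_tendsto_zero.2 (hx x)) (.of_forall fun n => hspan x n)
  rw [huniv] at hS
  exact TopologicalSpace.isSeparable_univ_iff.1 hS

end Enumeration

theorem isDirectSumOfMatrixAlgebras (h : τ.IsCompleteTracial) (hdiff : ¬ HasDiffuseSummand A) :
    IsDirectSumOfMatrixAlgebras A ∧ TopologicalSpace.SeparableSpace (L2 A τ) := by
  obtain ⟨I, b, horth, hall⟩ := h.exists_enumeration_blocks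
  exact ⟨h.isDirectSum_of_enumeration horth hall hdiff,
    h.separable_of_enumeration horth hall hdiff⟩

end IsCompleteTracial
end TracialState

/-! ### The filter of a character and countable incompleteness -/

namespace LinftyCharacter

variable {Ω : Type u} [MeasurableSpace Ω] {μ : Measure Ω} (U : LinftyCharacter μ)

/-- The filter of the sets whose indicator function is mapped to `1` by the character `U`. -/
def filter : Filter Ω where
  -- The function `g` dominates the indicator of the complement of `S` and is killed by `U`; in this
  -- form `S` need not be measurable.
  sets := {S | ∃ g : Lp ℂ ∞ μ, U g = 0 ∧ ∀ᵐ ω ∂μ, 0 ≤ (g ω).re ∧ (ω ∉ S → 1 ≤ (g ω).re)}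
  univ_sets := ⟨0, map_zero U, by
    filter_upwards [Lp.coeFn_zero ℂ ∞ μ] with ω hω
    rw [hω]
    simp⟩
  sets_of_superset := by
    rintro S T ⟨g, hg, h⟩ hST
    refine ⟨g, hg, ?_⟩
    filter_upwards [h] with ω hω
    exact ⟨hω.1, fun hT => hω.2 fun hS => hT (hST hS)⟩
  inter_sets := by
    rintro S T ⟨g, hg, h⟩ ⟨g', hg', h'⟩
    refine ⟨g + g', by rw [map_add, hg, hg', add_zero], ?_⟩
    filter_upwards [h, h', Lp.coeFn_add g g'] with ω h1 h2 h3
    rw [h3, Pi.add_apply, Complex.add_re]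
    refine ⟨add_nonneg h1.1 h2.1, fun hST => ?_⟩
    by_cases hS : ω ∈ S
    · linarith [h1.1, h2.2 fun hT => hST ⟨hS, hT⟩]
    · linarith [h1.2 hS, h2.1]

theorem mem_filter {S : Set Ω} : S ∈ U.filter ↔
    ∃ g : Lp ℂ ∞ μ, U g = 0 ∧ ∀ᵐ ω ∂μ, 0 ≤ (g ω).re ∧ (ω ∉ S → 1 ≤ (g ω).re) := Iff.rfl

instance : NeBot U.filter := by
  refine neBot_iff.2 fun hbot => ?_
  obtain ⟨g, hg, h⟩ := U.mem_filter.1 (empty_mem_iff_bot.2 hbot)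
  refine U.ne_zero_of_inv one_pos ?_ hg
  filter_upwards [h] with ω hω
  exact (hω.2 (Set.notMem_empty ω)).trans (Complex.re_le_norm _)

theorem filter_le_ae : U.filter ≤ ae μ := by
  intro S hS
  refine ⟨0, map_zero U, ?_⟩
  filter_upwards [Lp.coeFn_zero ℂ ∞ μ, hS] with ω hω hS
  rw [hω]
  simp [hS]

theorem ae_norm_le (f : Lp ℂ ∞ μ) : ∀ᵐ ω ∂μ, ‖f ω‖ ≤ ‖f‖ := by
  filter_upwards [ae_le_eLpNormEssSup (f := f) (μ := μ)] with ω h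
  rw [← eLpNorm_exponent_top, ← Lp.enorm_def] at h
  exact enorm_le_iff_norm_le.1 h

/-- Put `k = f - U f`, so that `U k = 0`. By multiplicativity `U` also kills `|k|² / ε²`, which is
at least `1` wherever `|k| ≥ ε`; it is the required witness. -/
theorem tendsto_filter (f : Lp ℂ ∞ μ) : Tendsto f U.filter (𝓝 (U f)) := by
  obtain ⟨e, he⟩ : ∃ e : Lp ℂ ∞ μ, ∀ᵐ ω ∂μ, e ω = 1 := by
    obtain ⟨e, -⟩ := U.exists_ne_zero
    have h : MemLp (fun _ : Ω => (1 : ℂ)) ∞ μ :=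
      memLp_top_of_bound aestronglyMeasurable_const 1 (.of_forall fun _ => by simp)
    exact ⟨h.toLp, h.coeFn_toLp⟩
  set k := f - U f • e with hk_def
  have hk : U k = 0 := by rw [hk_def, map_sub, map_smul, U.map_eq_one he]; simp
  have hkω : ∀ᵐ ω ∂μ, k ω = f ω - U f := by
    filter_upwards [he, Lp.coeFn_sub f (U f • e), Lp.coeFn_smul (U f) e] with ω h1 h2 h3
    rw [hk_def, h2, Pi.sub_apply, h3, Pi.smul_apply, h1, smul_eq_mul, mul_one]
  have hkm : AEMeasurable k μ := (Lp.aestronglyMeasurable k).aemeasurable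
  rw [Metric.tendsto_nhds]
  intro ε hε
  have h1 : MemLp (fun ω => ((ε⁻¹ ^ 2 : ℝ) : ℂ) * star (k ω)) ∞ μ := by
    refine memLp_top_of_bound
      ((Complex.continuous_conj.measurable.comp_aemeasurable hkm).const_mul _).aestronglyMeasurable
      (‖((ε⁻¹ ^ 2 : ℝ) : ℂ)‖ * ‖k‖) ?_
    filter_upwards [ae_norm_le k] with ω hω
    rw [norm_mul, norm_star]
    exact mul_le_mul_of_nonneg_left hω (norm_nonneg _)
  have h2 : MemLp (fun ω => (((ε⁻¹ * ‖k ω‖) ^ 2 : ℝ) : ℂ)) ∞ μ := by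
    refine memLp_top_of_bound (Complex.measurable_ofReal.comp_aemeasurable
      ((hkm.norm.const_mul _).pow_const 2)).aestronglyMeasurable ((ε⁻¹ * ‖k‖) ^ 2) ?_
    filter_upwards [ae_norm_le k] with ω hω
    rw [Complex.norm_real, Real.norm_of_nonneg (by positivity)]
    gcongr
  refine ⟨h2.toLp, ?_, ?_⟩
  · rw [U.map_mul_of_ae (f := h1.toLp) (g := k), hk, mul_zero]
    filter_upwards [h1.coeFn_toLp, h2.coeFn_toLp] with ω h3 h4
    rw [h3, h4, mul_assoc, Complex.star_def, Complex.conj_mul']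
    push_cast
    ring
  · filter_upwards [h2.coeFn_toLp, hkω] with ω h3 h4
    rw [h3, Complex.ofReal_re]
    refine ⟨by positivity, fun hω => ?_⟩
    have h5 : ε ≤ ‖k ω‖ := by
      rw [h4, ← dist_eq_norm]
      exact not_lt.1 hω
    refine one_le_pow₀ ?_
    rw [inv_mul_eq_div, one_le_div hε]
    exact h5

/-- The indicator function converges along the filter, and its limit cannot be within `1/2` of both
`0` and `1`. -/
theorem mem_or_compl_mem_filter {S : Set Ω} (hS : MeasurableSet S) :
    S ∈ U.filter ∨ Sᶜ ∈ U.filter := by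
  have h1 : MemLp (S.indicator fun _ => (1 : ℂ)) ∞ μ := by
    refine memLp_top_of_bound (measurable_const.indicator hS).aestronglyMeasurable 1
      (.of_forall fun ω => ?_)
    by_cases hω : ω ∈ S <;> simp [hω]
  have h2 : Tendsto (S.indicator fun _ => (1 : ℂ)) U.filter (𝓝 (U h1.toLp)) :=
    (U.tendsto_filter h1.toLp).congr' (U.filter_le_ae h1.coeFn_toLp)
  have h3 := Metric.tendsto_nhds.1 h2 (1 / 2) (by norm_num)
  by_cases hc : dist 1 (U h1.toLp) < 1 / 2
  · left
    filter_upwards [h3] with ω hω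
    by_contra hωS
    rw [Set.indicator_of_notMem hωS] at hω
    have := dist_triangle_right (1 : ℂ) 0 (U h1.toLp)
    rw [dist_zero_right, norm_one] at this
    linarith
  · right
    filter_upwards [h3] with ω hω hωS
    rw [Set.indicator_of_mem hωS] at hω
    exact hc hω

/-- The filter of a character that is not a point mass is countably incomplete. -/
theorem exists_iInter_eq_empty [StandardBorelSpace Ω] (hU : ¬ U.IsPointMass) :
    ∃ S : ℕ → Set Ω, (∀ n, MeasurableSet (S n)) ∧ (∀ n, S n ∈ U.filter) ∧ ⋂ n, S n = ∅ := by
  classical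
  let B := MeasurableSpace.natGeneratingSequence Ω
  have hB : ∀ n, MeasurableSet (B n) := MeasurableSpace.measurableSet_natGeneratingSequence
  let S : ℕ → Set Ω := fun n => if B n ∈ U.filter then B n else (B n)ᶜ
  have hS : ∀ n, MeasurableSet (S n) := fun n => by
    simp only [S]
    split_ifs
    exacts [hB n, (hB n).compl]
  have hSU : ∀ n, S n ∈ U.filter := fun n => by
    simp only [S]
    split_ifs with h
    exacts [h, (U.mem_or_compl_mem_filter (hB n)).resolve_left h]
  -- For every `n` the filter chooses between `B n` and its complement. Since the `B n` separate
  -- points, at most one point is compatible with all the choices.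
  have hsub : (⋂ n, S n).Subsingleton := by
    intro x hx y hy
    refine MeasurableSpace.injective_mapNatBool Ω (funext fun n => ?_)
    have h1 := Set.mem_iInter.1 hx n
    have h2 := Set.mem_iInter.1 hy n
    simp only [S] at h1 h2
    unfold MeasurableSpace.mapNatBool
    refine decide_eq_decide.2 ?_
    change x ∈ B n ↔ y ∈ B n
    split_ifs at h1 h2
    exacts [iff_of_true h1 h2, iff_of_false h1 h2]
  rcases hsub.eq_empty_or_singleton with h0 | ⟨x, hx⟩
  · exact ⟨S, hS, hSU, h0⟩
  -- If the singleton of the remaining point belonged to the filter, `U` would be evaluation at that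
  -- point, which would have positive mass because the filter lies below `ae μ`. So its complement
  -- belongs to the filter and can be intersected with all `S n`.
  · rcases U.mem_or_compl_mem_filter (measurableSet_singleton x) with h1 | h1
    · refine absurd ⟨x, fun h0 => ?_, fun f => ?_⟩ hU
      · have h2 : ({x} : Set Ω)ᶜ ∈ U.filter := U.filter_le_ae (compl_mem_ae_iff.2 h0)
        have := inter_mem h1 h2
        rw [Set.inter_compl_self] at this
        exact empty_notMem _ this
      · have h2 : Tendsto f U.filter (𝓝 (f x)) := by
          refine tendsto_const_nhds.congr' ?_
          filter_upwards [h1] with ω hω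
          rw [Set.mem_singleton_iff.1 hω]
        exact tendsto_nhds_unique (U.tendsto_filter f) h2
    · refine ⟨fun n => S n ∩ {x}ᶜ, fun n => (hS n).inter (measurableSet_singleton x).compl,
        fun n => inter_mem (hSU n) h1, ?_⟩
      rw [← Set.iInter_inter, hx, Set.inter_compl_self]

/-- A measurable index function along which countably many conditions are diagonalized. -/
theorem exists_index [StandardBorelSpace Ω] (hU : ¬ U.IsPointMass) {G : ℕ → Set Ω}
    (hG : ∀ n, NullMeasurableSet (G n) μ) (hGU : ∀ n, G n ∈ U.filter) :
    ∃ m : Ω → ℕ, (∀ n, NullMeasurableSet {ω | m ω = n} μ) ∧ (∀ n, ∀ᶠ ω in U.filter, n ≤ m ω) ∧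
      ∀ ω n, 0 < n → n ≤ m ω → ω ∈ G n := by
  classical
  obtain ⟨S, hS, hSU, hSe⟩ := U.exists_iInter_eq_empty hU
  -- The index `m ω` is the first `n` with `ω ∉ H n`; it exists since the `S n` have empty
  -- intersection. With `G` shifted by one, `n ≤ m ω` gives membership in `G n` for positive `n`.
  let H : ℕ → Set Ω := fun n => S n ∩ (G (n + 1) ∩ S (n + 1))
  have hex : ∀ ω, ∃ n, ω ∉ H n := by
    intro ω
    by_contra! hc
    have : ω ∈ ⋂ n, S n := Set.mem_iInter.2 fun n => (hc n).1
    rw [hSe] at this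
    exact this
  have hH : ∀ n, NullMeasurableSet (H n) μ := fun n =>
    (hS n).nullMeasurableSet.inter ((hG _).inter (hS _).nullMeasurableSet)
  refine ⟨fun ω => Nat.find (hex ω), fun n => ?_, fun n => ?_, fun ω n hn hnm => ?_⟩
  · have : {ω | Nat.find (hex ω) = n} = (H n)ᶜ ∩ ⋂ j : Fin n, H j := by
      ext ω
      simp only [Set.mem_ofPred_eq, Nat.find_eq_iff, Set.mem_inter_iff, Set.mem_iInter,
        Set.mem_compl_iff, not_not]
      exact and_congr_right fun _ => ⟨fun h j => h j j.2, fun h j hj => h ⟨j, hj⟩⟩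
    rw [this]
    exact (hH n).compl.inter (.iInter fun j => hH j)
  · have : ∀ᶠ ω in U.filter, ∀ j ∈ Finset.range n, ω ∈ H j := by
      rw [Filter.eventually_all_finset]
      exact fun j _ => inter_mem (hSU j) (inter_mem (hGU _) (hSU _))
    filter_upwards [this] with ω hω
    refine (Nat.le_find_iff _ _).2 fun j hj => not_not.2 (hω j (Finset.mem_range.2 hj))
  · obtain ⟨k, rfl⟩ := Nat.exists_eq_succ_of_ne_zero hn.ne'
    have := Nat.find_min (hex ω) (Nat.lt_of_succ_le hnm)
    exact (not_not.1 this).2.1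

end LinftyCharacter

/-! ### Functional calculus estimates in a single fiber -/

namespace TracialState

section CStar

variable {A : Type u} [CStarAlgebra A] (τ : TracialState A)

/-- The element `‖x‖² - x⋆ x` is positive, hence of the form `w⋆ w`. This turns operator norm bounds
in the fibers into `OpBound` in the ultrafiber. -/
theorem norm2_mul_le (x y : A) : τ.norm2 (x * y) ≤ ‖x‖ * τ.norm2 y := by
  let _ := CStarAlgebra.spectralOrder A
  have := CStarAlgebra.spectralOrderedRing A
  have h1 : star x * x ≤ algebraMap ℝ A ‖star x * x‖ :=
    (IsSelfAdjoint.star_mul_self x).le_algebraMap_norm_self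
  obtain ⟨w, hw⟩ := CStarAlgebra.nonneg_iff_eq_star_mul_self.1 (sub_nonneg.2 h1)
  have h2 := norm2_mul_sq_le_of_add_eq (τ := τ) (C := ‖x‖) (x := x) (w := w) (z := 1) (by
    rw [← hw, add_sub_cancel, CStarRing.norm_star_mul_self, Algebra.algebraMap_eq_smul_one,
      Complex.coe_smul, sq]) y
  rw [mul_one, ← norm2_sq, ← mul_pow] at h2
  exact (pow_le_pow_iff_left₀ (τ.norm2_nonneg _)
    (mul_nonneg (norm_nonneg _) (τ.norm2_nonneg _)) two_ne_zero).1 h2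

theorem norm2_cfc_sq {a : A} {φ : ℝ → ℝ} (hφ : Continuous φ) :
    τ.norm2 (cfc φ a) ^ 2 = (τ (cfc (fun t => φ t * φ t) a)).re := by
  rw [norm2_sq, cfc_predicate φ a |>.star_eq, ← cfc_mul φ φ a]

theorem re_apply_cfc_nonneg {a : A} {φ : ℝ → ℝ} (hφ : Continuous φ)
    (h0 : ∀ t, 0 ≤ φ t) : 0 ≤ (τ (cfc φ a)).re := by
  have h1 : φ = fun t => √(φ t) * √(φ t) := funext fun t => (Real.mul_self_sqrt (h0 t)).symm
  rw [h1, ← norm2_cfc_sq τ (hφ.sqrt)]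
  positivity

/-- An estimate for the excess of `a` over its truncation at level `C`. -/
theorem norm2_excess_le {a : A} (ha : IsSelfAdjoint a) {C : ℝ} (hC : 0 ≤ C) :
    C ^ 2 * τ.norm2 (cfc (fun t => t - max (-C) (min C t)) a) ^ 2 +
      τ.norm2 (cfc (fun t => t - max (-C) (min C t)) a *
        cfc (fun t => t - max (-C) (min C t)) a) ^ 2 ≤
    τ.norm2 (a * cfc (fun t => t - max (-C) (min C t)) a) ^ 2 := by
  set δ : ℝ → ℝ := fun t => t - max (-C) (min C t) with hδ
  have hδc : Continuous δ := by fun_prop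
  have h1 : a * cfc δ a = cfc (fun t => t * δ t) a := by
    rw [cfc_mul (fun t => t) δ a, cfc_id' ℝ a]
  rw [h1, ← cfc_mul δ δ a, norm2_cfc_sq τ hδc, norm2_cfc_sq τ (by fun_prop),
    norm2_cfc_sq τ (by fun_prop)]
  have h2 := τ.re_apply_cfc_nonneg (a := a)
    (φ := fun t => t * δ t * (t * δ t) - (C ^ 2 * (δ t * δ t) + δ t * δ t * (δ t * δ t)))
    (by fun_prop) (fun t => by
      -- Where `δ t ≠ 0`, one has `|t| = C + |δ t|`, hence `t² ≥ C² + δ(t)²`.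
      have key : C ^ 2 * (δ t * δ t) + δ t * δ t * (δ t * δ t) ≤ t * δ t * (t * δ t) := by
        have h3 : t * δ t * (t * δ t) = t ^ 2 * (δ t * δ t) := by ring
        rw [h3, ← add_mul]
        by_cases h4 : δ t = 0
        · simp [h4]
        · refine mul_le_mul_of_nonneg_right ?_ (mul_self_nonneg _)
          simp only [hδ] at h4 ⊢
          rcases le_total C t with h5 | h5
          · rw [min_eq_left h5, max_eq_right (by linarith)]
            nlinarith
          · rw [min_eq_right h5] at h4 ⊢
            rcases le_total (-C) t with h6 | h6
            · rw [max_eq_right h6] at h4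
              exact absurd (sub_self t) h4
            · rw [max_eq_left h6]
              nlinarith
      linarith)
  rw [cfc_sub _ _ a, cfc_add (a := a) _ _, cfc_const_mul _ _ a, map_sub, map_add, Complex.sub_re,
    Complex.add_re, ← Complex.coe_smul, map_smul, smul_eq_mul, Complex.re_ofReal_mul] at h2
  linarith

end CStar

end TracialState

/-! ### Sections and their classes in the ultrafiber -/

namespace MeasurableField

variable {Ω : Type u} [MeasurableSpace Ω] {μ : Measure Ω} (M : MeasurableField.{u, v} μ)
  (U : LinftyCharacter μ)

/-- The class of a bounded measurable section in the ultrafiber. -/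
noncomputable def toUltrafiber : M.boundedMeasurableSections →⋆ₐ[ℂ] M.Ultrafiber U :=
  StarAlgHom.comp
    { toAlgHom := Ideal.Quotient.mkₐ ℂ (M.characterState U).nullIdeal
      map_star' := fun _ => rfl } M.toDirectIntegral

theorem toUltrafiber_surjective : Function.Surjective (M.toUltrafiber U) :=
  Ideal.Quotient.mk_surjective.comp M.toDirectIntegral_surjective

theorem tendsto_tr (f : M.boundedMeasurableSections) :
    Tendsto (fun ω => M.tr ω (f.1 ω)) U.filter
      (𝓝 (M.ultrafiberTrace U (M.toUltrafiber U f))) :=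
  (U.tendsto_filter (M.expectation (M.toDirectIntegral f))).congr'
    (U.filter_le_ae (M.expectation_toDirectIntegral f))

theorem tendsto_norm2 (f : M.boundedMeasurableSections) :
    Tendsto (fun ω => (M.tr ω).norm2 (f.1 ω)) U.filter
      (𝓝 ((M.ultrafiberTrace U).norm2 (M.toUltrafiber U f))) := by
  have h := M.tendsto_tr U (star f * f)
  rw [map_mul, map_star] at h
  exact (Complex.continuous_re.tendsto _ |>.comp h).sqrt

theorem aemeasurable_norm2_section (f : M.boundedMeasurableSections) :
    AEMeasurable (fun ω => (M.tr ω).norm2 (f.1 ω)) μ :=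
  M.aemeasurable_norm2 (f.2.1.star_mul_self M f.2.2)

theorem opBound_toUltrafiber {f : M.boundedMeasurableSections} {C : ℝ}
    (hC : ∀ ω, ‖f.1 ω‖ ≤ C) : (M.ultrafiberTrace U).OpBound C (M.toUltrafiber U f) := by
  intro y
  obtain ⟨g, rfl⟩ := M.toUltrafiber_surjective U y
  rw [← map_mul]
  refine le_of_tendsto_of_tendsto' (M.tendsto_norm2 U (f * g))
    ((M.tendsto_norm2 U g).const_mul C) fun ω => ?_
  exact ((M.tr ω).norm2_mul_le _ _).trans
    (mul_le_mul_of_nonneg_right (hC ω) ((M.tr ω).norm2_nonneg _))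

/-- The common bound on the `f n` is what keeps the glued section bounded. -/
theorem exists_glue (f : ℕ → M.boundedMeasurableSections) {C : ℝ} (hC : ∀ n ω, ‖(f n).1 ω‖ ≤ C)
    {m : Ω → ℕ} (hm : ∀ n, NullMeasurableSet {ω | m ω = n} μ) :
    ∃ g : M.boundedMeasurableSections, ∀ ω, g.1 ω = (f (m ω)).1 ω :=
  ⟨⟨fun ω => (f (m ω)).1 ω, fun n => aemeasurable_select
    (F := fun k ω => M.tr ω (M.e n ω * (f k).1 ω)) (fun k => (f k).2.1 n) hm, C,
    fun ω => hC _ ω⟩, fun _ => rfl⟩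

/-- All the spectra lie in one interval `[-C, C]`, so Weierstrass approximation is uniform in `ω`,
and measurability passes from polynomials to the limit. -/
theorem exists_cfc_section (f : M.boundedMeasurableSections)
    (hf : ∀ ω, IsSelfAdjoint (f.1 ω)) {φ : ℝ → ℝ} (hφ : Continuous φ) :
    ∃ g : M.boundedMeasurableSections, ∀ ω, g.1 ω = cfc φ (f.1 ω) := by
  obtain ⟨C, hC⟩ := f.2.2
  have hspec : ∀ ω, ∀ t ∈ spectrum ℝ (f.1 ω), t ∈ Set.Icc (-C) C := by
    intro ω t ht
    cases subsingleton_or_nontrivial (M.Fiber ω)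
    · exact absurd ht (by simp [spectrum.of_subsingleton])
    · exact abs_le.1 ((spectrum.norm_le_norm_of_mem ht).trans (hC ω))
  choose p hp using fun n : ℕ => exists_polynomial_near_of_continuousOn (-C) C φ hφ.continuousOn
    (1 / ((n : ℝ) + 1)) (by positivity)
  have haeval : ∀ n ω, (Polynomial.aeval f ((p n).map (algebraMap ℝ ℂ))).1 ω =
      cfc (p n).eval (f.1 ω) := by
    intro n ω
    rw [cfc_polynomial (p n) (f.1 ω) (hf ω), ← Polynomial.aeval_map_algebraMap ℂ (f.1 ω) (p n)]
    exact (Polynomial.aeval_algHom_apply ((Pi.evalAlgHom ℂ M.Fiber ω).comp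
      M.boundedMeasurableSections.subtype.toAlgHom) f _).symm
  have hdist : ∀ n ω, ‖cfc φ (f.1 ω) - cfc (p n).eval (f.1 ω)‖ ≤ 1 / ((n : ℝ) + 1) := by
    intro n ω
    rw [← cfc_sub φ (p n).eval (f.1 ω) (by fun_prop) (by fun_prop)]
    refine norm_cfc_le (by positivity) fun t ht => ?_
    rw [norm_sub_rev]
    exact (hp n t (hspec ω t ht)).le
  obtain ⟨K, hK⟩ := isCompact_Icc.exists_bound_of_continuousOn (hφ.continuousOn (s := Set.Icc (-C) C))
  refine ⟨⟨fun ω => cfc φ (f.1 ω), fun k => ?_, max K 0, fun ω => ?_⟩, fun ω => rfl⟩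
  · refine aemeasurable_of_tendsto_metrizable_ae' (f := fun n ω =>
      M.tr ω (M.e k ω * (Polynomial.aeval f ((p n).map (algebraMap ℝ ℂ))).1 ω))
      (fun n => (Polynomial.aeval f ((p n).map (algebraMap ℝ ℂ))).2.1 k) (.of_forall fun ω => ?_)
    rw [tendsto_iff_norm_sub_tendsto_zero]
    refine squeeze_zero (fun _ => norm_nonneg _) (fun n => ?_) tendsto_one_div_add_atTop_nhds_zero_nat
    rw [← map_sub, ← mul_sub, haeval]
    refine ((M.tr ω).norm_apply_le _).trans ((norm_mul_le _ _).trans ?_)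
    refine (mul_le_of_le_one_left (norm_nonneg _) (M.norm_e_le k ω)).trans ?_
    rw [norm_sub_rev]
    exact hdist n ω
  · exact norm_cfc_le (le_max_right _ _) fun t ht => (hK t (hspec ω t ht)).trans (le_max_left _ _)

theorem exists_selfAdjoint_lift {x : M.Ultrafiber U} (hx : IsSelfAdjoint x) :
    ∃ f : M.boundedMeasurableSections, M.toUltrafiber U f = x ∧ ∀ ω, IsSelfAdjoint (f.1 ω) := by
  obtain ⟨f, rfl⟩ := M.toUltrafiber_surjective U x
  refine ⟨((1 / 2 : ℝ) : ℂ) • (f + star f), ?_, fun ω => ?_⟩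
  · rw [map_smul, map_add, map_star, hx.star_eq, ← two_smul ℂ, smul_smul]
    norm_num
  · change star (((1 / 2 : ℝ) : ℂ) • (f.1 ω + star (f.1 ω))) =
      ((1 / 2 : ℝ) : ℂ) • (f.1 ω + star (f.1 ω))
    rw [star_smul, Complex.star_def, Complex.conj_ofReal, star_add, star_star, add_comm]

theorem ultrafiberTrace_faithful (x : M.Ultrafiber U)
    (hx : M.ultrafiberTrace U (star x * x) = 0) : x = 0 :=
  (M.characterState U).quotientState_faithful x hx

/-- Self-adjoint elements of the ultrafiber lift to sections with the same bound. -/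
theorem exists_bounded_lift {x : M.Ultrafiber U} (hx : IsSelfAdjoint x) {C : ℝ} (hC : 0 ≤ C)
    (hxC : (M.ultrafiberTrace U).OpBound C x) :
    ∃ f : M.boundedMeasurableSections, M.toUltrafiber U f = x ∧ ∀ ω, ‖f.1 ω‖ ≤ C := by
  obtain ⟨f, hfx, hf⟩ := M.exists_selfAdjoint_lift U hx
  set τ := M.ultrafiberTrace U
  obtain ⟨g, hg⟩ := M.exists_cfc_section f hf (φ := fun t => max (-C) (min C t)) (by fun_prop)
  obtain ⟨d, hd⟩ := M.exists_cfc_section f hf (φ := fun t => t - max (-C) (min C t)) (by fun_prop)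
  have hds : IsSelfAdjoint d := Subtype.ext (funext fun ω => by
    change star (d.1 ω) = d.1 ω
    rw [hd]
    exact (IsSelfAdjoint.cfc (R := ℝ)).star_eq)
  have hDs : IsSelfAdjoint (M.toUltrafiber U d) := hds.map _
  have hfgd : f = g + d := Subtype.ext (funext fun ω => by
    change f.1 ω = g.1 ω + d.1 ω
    rw [hg, hd, ← cfc_add (a := f.1 ω) _ _]
    conv_lhs => rw [← cfc_id' ℝ (f.1 ω) (hf ω)]
    exact congrArg (fun φ => cfc φ (f.1 ω)) (funext fun t => (add_sub_cancel _ t).symm))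
  -- Here `d` is the excess of `f` over its truncation `g`. The fiberwise estimate passes to the
  -- limit, and `OpBound C x` bounds its right side by the first term on the left. Thus `d²`, and by
  -- self-adjointness `d`, vanishes in the ultrafiber, so `g` is also a lift of `x`.
  have h1 : C ^ 2 * τ.norm2 (M.toUltrafiber U d) ^ 2 +
      τ.norm2 (M.toUltrafiber U d * M.toUltrafiber U d) ^ 2 ≤
      τ.norm2 (x * M.toUltrafiber U d) ^ 2 := by
    rw [← hfx, ← map_mul, ← map_mul]
    refine le_of_tendsto_of_tendsto' ((((M.tendsto_norm2 U d).pow 2).const_mul (C ^ 2)).add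
      ((M.tendsto_norm2 U (d * d)).pow 2)) ((M.tendsto_norm2 U (f * d)).pow 2) fun ω => ?_
    have := (M.tr ω).norm2_excess_le (hf ω) hC
    rw [← hd] at this
    exact this
  have h2 := pow_le_pow_left₀ (τ.norm2_nonneg _) (hxC (M.toUltrafiber U d)) 2
  rw [mul_pow] at h2
  have h3 : τ.norm2 (M.toUltrafiber U d * M.toUltrafiber U d) = 0 :=
    pow_eq_zero_iff two_ne_zero |>.1 (le_antisymm (by linarith) (sq_nonneg _))
  have h4 := M.ultrafiberTrace_faithful U _ ((τ.apply_eq_zero_iff _).2 h3)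
  have h5 : M.toUltrafiber U d = 0 := M.ultrafiberTrace_faithful U _ (by
    rw [hDs.star_eq, h4, map_zero])
  refine ⟨g, ?_, fun ω => ?_⟩
  · rw [← hfx, hfgd, map_add, h5, add_zero]
  · rw [hg]
    refine norm_cfc_le hC fun t _ => abs_le.2 ⟨le_max_left _ _, max_le (by linarith) (min_le_left _ _)⟩

/-- The square roots of the fiberwise positive and negative parts of a self-adjoint lift are bounded
measurable sections, and the required identities hold fiber by fiber. -/
theorem exists_decomp {x : M.Ultrafiber U} (hx : IsSelfAdjoint x) :
    ∃ y z : M.Ultrafiber U, IsSelfAdjoint y ∧ IsSelfAdjoint z ∧ y * z = 0 ∧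
      x = y * y - z * z := by
  obtain ⟨f, rfl, hf⟩ := M.exists_selfAdjoint_lift U hx
  obtain ⟨y, hy⟩ := M.exists_cfc_section f hf (φ := fun t => √(max t 0)) (by fun_prop)
  obtain ⟨z, hz⟩ := M.exists_cfc_section f hf (φ := fun t => √(max (-t) 0)) (by fun_prop)
  have hys : IsSelfAdjoint y := Subtype.ext (funext fun ω => by
    change star (y.1 ω) = y.1 ω
    rw [hy]
    exact (IsSelfAdjoint.cfc (R := ℝ)).star_eq)
  have hzs : IsSelfAdjoint z := Subtype.ext (funext fun ω => by
    change star (z.1 ω) = z.1 ω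
    rw [hz]
    exact (IsSelfAdjoint.cfc (R := ℝ)).star_eq)
  have hyz : y * z = 0 := Subtype.ext (funext fun ω => by
    change y.1 ω * z.1 ω = 0
    rw [hy, hz, ← cfc_mul _ _ (f.1 ω), ← cfc_zero ℝ (f.1 ω)]
    refine congrArg (fun φ => cfc φ (f.1 ω)) (funext fun t => ?_)
    rcases le_total t 0 with ht | ht
    · simp [max_eq_right ht]
    · simp [max_eq_right (neg_nonpos.2 ht)])
  have hd : f = y * y - z * z := Subtype.ext (funext fun ω => by
    change f.1 ω = y.1 ω * y.1 ω - z.1 ω * z.1 ω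
    rw [hy, hz, ← cfc_mul _ _ (f.1 ω), ← cfc_mul _ _ (f.1 ω), ← cfc_sub _ _ (f.1 ω)]
    conv_lhs => rw [← cfc_id' ℝ (f.1 ω) (hf ω)]
    refine congrArg (fun φ => cfc φ (f.1 ω)) (funext fun t => ?_)
    rw [Real.mul_self_sqrt (le_max_right _ _), Real.mul_self_sqrt (le_max_right _ _)]
    rcases le_total t 0 with ht | ht
    · rw [max_eq_right ht, max_eq_left (neg_nonneg.2 ht)]; ring
    · rw [max_eq_left ht, max_eq_right (neg_nonpos.2 ht)]; ring)
  refine ⟨M.toUltrafiber U y, M.toUltrafiber U z, hys.map _, hzs.map _, ?_, ?_⟩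
  · rw [← map_mul, hyz, map_zero]
  · rw [← map_mul, ← map_mul, ← map_sub, ← hd]

end MeasurableField

/-! ### Density characters and the upper cardinality bound -/

theorem densityCharacter_ge {X : Type u} [PseudoMetricSpace X] {ι : Type v} (F : ι → X) {ε : ℝ}
    (hε : 0 < ε) (hF : ∀ i j, i ≠ j → ε ≤ dist (F i) (F j)) :
    Cardinal.lift.{u} (Cardinal.mk ι) ≤ Cardinal.lift.{v} (densityCharacter X) := by
  obtain ⟨s, hs, hcard⟩ := csInf_mem
    (⟨_, Set.univ, dense_univ, rfl⟩ : {κ | ∃ s : Set X, Dense s ∧ Cardinal.mk s = κ}.Nonempty)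
  change Cardinal.mk s = densityCharacter X at hcard
  rw [← hcard]
  choose g hgs hg using fun i => hs.exists_dist_lt (F i) (half_pos hε)
  refine Cardinal.lift_mk_le_lift_mk_of_injective (f := fun i => (⟨g i, hgs i⟩ : s)) ?_
  intro i j hij
  by_contra hne
  have h1 : g i = g j := congrArg Subtype.val hij
  have h2 := dist_triangle_right (F i) (F j) (g i)
  have h3 := hg i
  have h4 := hg j
  rw [← h1] at h4
  linarith [hF i j hne]

theorem densityCharacter_le_mk (X : Type u) [TopologicalSpace X] :
    densityCharacter X ≤ Cardinal.mk X :=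
  csInf_le' ⟨Set.univ, dense_univ, Cardinal.mk_univ⟩

namespace MeasurableField

variable {Ω : Type u} [MeasurableSpace Ω] {μ : Measure Ω} (M : MeasurableField.{u, v} μ)
  (U : LinftyCharacter μ)

/-- Rescaled `e n` approximate `star x` in 2-norm, which forces `τ(x⋆ x) = 0`. -/
theorem norm2_eq_zero_of_forall_tr_eq_zero {ω : Ω} {x : M.Fiber ω}
    (hx : ∀ n, M.tr ω (M.e n ω * x) = 0) : (M.tr ω).norm2 x = 0 := by
  have hC : 0 < ‖star x‖ + 1 := by positivity
  have h1 : ∀ ε > 0, ‖M.tr ω (star x * x)‖ ≤ ε * (M.tr ω).norm2 x := by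
    intro ε hε
    obtain ⟨n, hn⟩ := M.exists_norm2_sub_lt hC ω (x := star x) (by linarith) hε
    have h2 : M.tr ω (star x * x) =
        M.tr ω ((star x - ((‖star x‖ + 1 : ℝ) : ℂ) • M.e n ω) * x) := by
      rw [sub_mul, map_sub, smul_mul_assoc, map_smul, hx, smul_zero, sub_zero]
    rw [h2]
    exact ((M.tr ω).norm_apply_mul_le _ _).trans
      (mul_le_mul_of_nonneg_right hn.le ((M.tr ω).norm2_nonneg _))
  refine ((M.tr ω).apply_eq_zero_iff x).1 (norm_le_zero_iff.1 (le_of_forall_pos_le_add ?_))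
  intro ε hε
  have h3 := (M.tr ω).norm2_nonneg x
  refine (h1 (ε / ((M.tr ω).norm2 x + 1)) (by positivity)).trans ?_
  rw [zero_add, div_mul_eq_mul_div, div_le_iff₀ (by positivity)]
  nlinarith

theorem toUltrafiber_eq_of_ae {f g : M.boundedMeasurableSections}
    (hfg : ∀ n, (fun ω => M.tr ω (M.e n ω * f.1 ω)) =ᵐ[μ] fun ω => M.tr ω (M.e n ω * g.1 ω)) :
    M.toUltrafiber U f = M.toUltrafiber U g := by
  rw [← sub_eq_zero, ← map_sub]
  refine M.ultrafiberTrace_faithful U _ (((M.ultrafiberTrace U).apply_eq_zero_iff _).2 ?_)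
  refine tendsto_nhds_unique (M.tendsto_norm2 U (f - g)) (tendsto_const_nhds.congr' ?_)
  refine U.filter_le_ae ?_
  filter_upwards [ae_all_iff.2 hfg] with ω hω
  refine (M.norm2_eq_zero_of_forall_tr_eq_zero fun n => ?_).symm
  change M.tr ω (M.e n ω * (f.1 ω - g.1 ω)) = 0
  rw [mul_sub, map_sub, hω n, sub_self]

/-- The class of a section is determined by measurable versions of the countably many functions
`τ(e_n f)`, and each of these by the preimages of a countable separating family in `ℂ`. There are at
most continuum many measurable sets in `Ω`, and a countable power of the continuum is the continuum.
-/
theorem mk_ultrafiber_le [MeasurableSpace.CountablyGenerated Ω] :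
    Cardinal.mk (M.Ultrafiber U) ≤ Cardinal.continuum := by
  have hΩ : Cardinal.mk {s : Set Ω // MeasurableSet s} ≤ Cardinal.continuum := by
    obtain ⟨b, hb, hgen⟩ := MeasurableSpace.CountablyGenerated.isCountablyGenerated (α := Ω)
    rw [hgen]
    exact MeasurableSpace.cardinal_measurableSet_le_continuum
      ((Cardinal.le_aleph0_iff_set_countable.2 hb).trans Cardinal.aleph0_le_continuum)
  choose f hf using M.toUltrafiber_surjective U
  let B := MeasurableSpace.natGeneratingSequence ℂ
  have hB : ∀ n, MeasurableSet (B n) := MeasurableSpace.measurableSet_natGeneratingSequence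
  let J : M.Ultrafiber U → (ℕ × ℕ → {s : Set Ω // MeasurableSet s}) := fun x p =>
    ⟨((f x).2.1 p.1).mk _ ⁻¹' B p.2, ((f x).2.1 p.1).measurable_mk (hB p.2)⟩
  have hJ : Function.Injective J := by
    intro x y hxy
    rw [← hf x, ← hf y]
    refine M.toUltrafiber_eq_of_ae U fun n => ?_
    refine ((f x).2.1 n).ae_eq_mk.trans (EventuallyEq.trans (.of_eq ?_)
      ((f y).2.1 n).ae_eq_mk.symm)
    funext ω
    refine MeasurableSpace.injective_mapNatBool ℂ (funext fun k => ?_)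
    have h1 := congrArg Subtype.val (congrFun hxy (n, k))
    exact decide_eq_decide.2 (Set.ext_iff.1 h1 ω)
  have h1 := Cardinal.lift_mk_le_lift_mk_of_injective hJ
  have h2 : Cardinal.mk (ℕ × ℕ → {s : Set Ω // MeasurableSet s}) ≤ Cardinal.continuum := by
    rw [Cardinal.mk_arrow]
    refine (Cardinal.power_le_power_right (Cardinal.lift_le_continuum.2 hΩ)).trans ?_
    simp
  have h3 := h1.trans (Cardinal.lift_le_continuum.2 h2)
  exact Cardinal.lift_le_continuum.1 h3

/-! ### Completeness and large separated families by diagonal gluing -/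

variable [StandardBorelSpace Ω] (hU : ¬ U.IsPointMass)
include hU

/-- Bounded lifts of a fast subsequence are glued along an index tending to infinity; on a set in
the filter the result is as close to each earlier term as the Cauchy condition predicts. -/
theorem exists_tendstoL2_of_selfAdjoint {x : ℕ → M.Ultrafiber U} (hx : ∀ n, IsSelfAdjoint (x n))
    {C : ℝ} (hC : 0 ≤ C) (hb : ∀ n, (M.ultrafiberTrace U).OpBound C (x n))
    (hc : ∀ ε > 0, ∃ N, ∀ m ≥ N, ∀ n ≥ N, (M.ultrafiberTrace U).norm2 (x m - x n) < ε) :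
    ∃ l, (M.ultrafiberTrace U).TendstoL2 x l := by
  set τ := M.ultrafiberTrace U
  choose f hf hfC using fun n => M.exists_bounded_lift U (hx n) hC (hb n)
  choose N' hN' using fun k : ℕ => hc (1 / ((k : ℝ) + 1)) (by positivity)
  -- Summing makes `N k` at least `N' j` for every `j ≤ k`, so the `1/(j+1)` Cauchy estimate applies
  -- to all later indices at once.
  let N : ℕ → ℕ := fun k => ∑ j ∈ Finset.range (k + 1), N' j
  have hN : ∀ j k, j ≤ k → N' j ≤ N k := fun j k hjk =>
    Finset.single_le_sum (f := N') (fun _ _ => Nat.zero_le _)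
      (Finset.mem_range.2 (Nat.lt_succ_of_le hjk))
  let G : ℕ → Set Ω := fun n => ⋂ k : Fin (n + 1),
    {ω | (M.tr ω).norm2 ((f (N k) - f (N n)).1 ω) < 1 / ((k : ℝ) + 1)}
  have hGm : ∀ n, NullMeasurableSet (G n) μ := fun n => .iInter fun k =>
    nullMeasurableSet_lt (M.aemeasurable_norm2_section _) aemeasurable_const
  have hGU : ∀ n, G n ∈ U.filter := fun n => by
    refine Filter.iInter_mem.2 fun k => ?_
    refine (M.tendsto_norm2 U (f (N k) - f (N n))).eventually_lt_const ?_
    rw [map_sub, hf, hf]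
    exact hN' k _ (hN k k le_rfl) _ (hN k n (Nat.le_of_lt_succ k.2))
  obtain ⟨m, hm, hmU, hmG⟩ := U.exists_index hU hGm hGU
  obtain ⟨g, hg⟩ := M.exists_glue (fun k => f (N k)) (fun k => hfC (N k)) hm
  refine ⟨M.toUltrafiber U g, ?_⟩
  have hdist : ∀ k : ℕ, τ.norm2 (x (N k) - M.toUltrafiber U g) ≤ 1 / ((k : ℝ) + 1) := by
    intro k
    rw [← hf (N k), ← map_sub]
    refine le_of_tendsto (M.tendsto_norm2 U (f (N k) - g)) ?_
    filter_upwards [hmU (k + 1)] with ω hω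
    have h1 := Set.mem_iInter.1 (hmG ω (m ω) (by omega) le_rfl) ⟨k, by omega⟩
    have h2 : (f (N k) - g).1 ω = (f (N k) - f (N (m ω))).1 ω := by
      change (f (N k)).1 ω - g.1 ω = (f (N k)).1 ω - (f (N (m ω))).1 ω
      rw [hg]
    rw [h2]
    exact le_of_lt h1
  refine Metric.tendsto_atTop.2 fun ε hε => ?_
  obtain ⟨k, hk⟩ := exists_nat_one_div_lt (half_pos hε)
  refine ⟨N k, fun n hn => ?_⟩
  rw [Real.dist_eq, sub_zero, abs_of_nonneg (τ.norm2_nonneg _)]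
  have h1 := τ.norm2_sub_le_norm2_sub_add (x n) (x (N k)) (M.toUltrafiber U g)
  have h2 := hN' k n ((hN k k le_rfl).trans hn) (N k) (hN k k le_rfl)
  have h3 := hdist k
  linarith

theorem exists_tendstoL2 {x : ℕ → M.Ultrafiber U} {C : ℝ}
    (hb : ∀ n, (M.ultrafiberTrace U).OpBound C (x n))
    (hc : ∀ ε > 0, ∃ N, ∀ m ≥ N, ∀ n ≥ N, (M.ultrafiberTrace U).norm2 (x m - x n) < ε) :
    ∃ l, (M.ultrafiberTrace U).TendstoL2 x l := by
  set τ := M.ultrafiberTrace U with hτ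
  replace hb : ∀ n, τ.OpBound (max C 0) (x n) := fun n => (hb n).mono (le_max_left _ _)
  -- The values `c = 1` and `c = I` give twice the real part and, up to sign, twice the imaginary
  -- part, which reduces to self-adjoint sequences.
  have key : ∀ c : ℂ, ‖c‖ = 1 → ∃ l, τ.TendstoL2 (fun n => c • x n + star (c • x n)) l := by
    intro c hc1
    have hb' : ∀ n, τ.OpBound (max C 0) (c • x n) := fun n => by
      simpa [hc1] using (hb n).smul c
    refine M.exists_tendstoL2_of_selfAdjoint U hU (fun n => ?_)
      (add_nonneg (le_max_right C 0) (le_max_right C 0)) (fun n => (hb' n).add (hb' n).star) ?_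
    · rw [IsSelfAdjoint, star_add, star_star, add_comm]
    · intro ε hε
      obtain ⟨N, hN⟩ := hc (ε / 2) (half_pos hε)
      refine ⟨N, fun m hm n hn => ?_⟩
      have h1 : c • x m + star (c • x m) - (c • x n + star (c • x n)) =
          c • (x m - x n) + star (c • (x m - x n)) := by
        rw [smul_sub, star_sub]
        abel
      rw [h1]
      refine (τ.norm2_add_le _ _).trans_lt ?_
      rw [τ.norm2_star, τ.norm2_smul, hc1, one_mul]
      linarith [hN m hm n hn]
  obtain ⟨a, ha⟩ := key 1 (by simp)
  obtain ⟨b, hb⟩ := key Complex.I (by simp)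
  refine ⟨(1 / 2 : ℂ) • (a - Complex.I • b), ((ha.sub (hb.smul Complex.I)).smul (1 / 2 : ℂ)).congr
    (.of_forall fun n => ?_)⟩
  simp only [star_smul, one_smul, smul_add, smul_smul, Complex.star_def, Complex.conj_I]
  simp only [mul_neg, Complex.I_mul_I, neg_neg, one_smul]
  rw [← sub_eq_zero]
  module

/-- The ultrafiber has the properties of a tracial von Neumann algebra. -/
theorem isCompleteTracial : (M.ultrafiberTrace U).IsCompleteTracial where
  faithful := M.ultrafiberTrace_faithful U
  bounded x := by
    obtain ⟨f, rfl⟩ := M.toUltrafiber_surjective U x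
    obtain ⟨C, hC⟩ := f.2.2
    exact ⟨max C 1, by positivity, M.opBound_toUltrafiber U fun ω =>
      (hC ω).trans (le_max_left _ _)⟩
  complete _ _ hb hc := M.exists_tendstoL2 U hU hb hc
  decomp _ hx := M.exists_decomp U hx

/-- For `n = m ω`, the section attached to a binary sequence follows the one attached to its first
`n` digits. Two sequences that differ at `k` have different initial segments as soon as `m ω ≥ k +
1`, which holds along the filter. -/
theorem exists_separated_family (hdiff : HasDiffuseSummand (M.Ultrafiber U)) :
    ∃ (ε : ℝ) (F : (ℕ → Bool) → M.Ultrafiber U), 0 < ε ∧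
      ∀ ξ η, ξ ≠ η → ε ≤ (M.ultrafiberTrace U).norm2 (F ξ - F η) := by
  have h := M.isCompleteTracial U hU
  set τ := M.ultrafiberTrace U
  obtain ⟨p, hp, -, hp0, hpd⟩ := hdiff
  have hδ := h.norm2_pos hp0
  choose u hus hub hud using fun n : ℕ => h.exists_separated hp hpd (Fin n → Bool)
  choose f hf hfC using fun n s => M.exists_bounded_lift U (hus n s) zero_le_one (hub n s)
  -- Distances of at least `‖p‖₂` in the ultrafiber only persist approximately in the fibers, so the
  -- separation is relaxed to `‖p‖₂ / 2`, for the finitely many pairs at level `n`.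
  let G : ℕ → Set Ω := fun n => ⋂ q : {q : (Fin n → Bool) × (Fin n → Bool) // q.1 ≠ q.2},
    {ω | τ.norm2 p / 2 < (M.tr ω).norm2 ((f n q.1.1 - f n q.1.2).1 ω)}
  have hGm : ∀ n, NullMeasurableSet (G n) μ := fun n => .iInter fun q =>
    nullMeasurableSet_lt aemeasurable_const (M.aemeasurable_norm2_section _)
  have hGU : ∀ n, G n ∈ U.filter := fun n => by
    refine Filter.iInter_mem.2 fun q => ?_
    refine (M.tendsto_norm2 U (f n q.1.1 - f n q.1.2)).eventually_const_lt ?_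
    rw [map_sub, hf, hf]
    exact (half_lt_self hδ).trans_le (hud n _ _ q.2)
  obtain ⟨m, hm, hmU, hmG⟩ := U.exists_index hU hGm hGU
  choose F hF using fun ξ : ℕ → Bool =>
    M.exists_glue (fun n => f n fun i => ξ i) (fun n => hfC n _) hm
  refine ⟨τ.norm2 p / 2, fun ξ => M.toUltrafiber U (F ξ), half_pos hδ, fun ξ η hne => ?_⟩
  obtain ⟨k, hk⟩ := Function.ne_iff.1 hne
  rw [← map_sub]
  refine ge_of_tendsto (M.tendsto_norm2 U (F ξ - F η)) ?_
  filter_upwards [hmU (k + 1)] with ω hω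
  have h1 := Set.mem_iInter.1 (hmG ω (m ω) (by omega) le_rfl)
    ⟨(fun i => ξ i, fun i => η i), fun hh => hk (congrFun hh ⟨k, by omega⟩)⟩
  have h2 : (F ξ - F η).1 ω =
      (f (m ω) (fun i => ξ i) - f (m ω) (fun i => η i)).1 ω := by
    change (F ξ).1 ω - (F η).1 ω = (f (m ω) _).1 ω - (f (m ω) _).1 ω
    rw [hF, hF]
  rw [h2]
  exact le_of_lt h1

theorem densityCharacter_eq_continuum (hdiff : HasDiffuseSummand (M.Ultrafiber U)) :
    densityCharacter (TracialState.L2 (M.Ultrafiber U) (M.ultrafiberTrace U)) =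
      Cardinal.continuum := by
  refine le_antisymm ((densityCharacter_le_mk _).trans (M.mk_ultrafiber_le U)) ?_
  obtain ⟨ε, F, hε, hF⟩ := M.exists_separated_family U hU hdiff
  let F' : (ℕ → Bool) → TracialState.L2 (M.Ultrafiber U) (M.ultrafiberTrace U) := F
  have hF' : ∀ ξ η, ξ ≠ η → ε ≤ dist (F' ξ) (F' η) := fun ξ η hne => by
    rw [dist_eq_norm]
    exact hF ξ η hne
  have h1 := densityCharacter_ge F' hε hF'
  simpa using h1

end MeasurableField

theorem mainTheorem11 {Ω : Type u} [MeasurableSpace Ω] [StandardBorelSpace Ω] (μ : Measure Ω)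
    [IsProbabilityMeasure μ] (U : LinftyCharacter μ) (hU : ¬ U.IsPointMass)
    (M : MeasurableField.{u, v} μ) :
    (HasDiffuseSummand (M.Ultrafiber U) →
      densityCharacter (TracialState.L2 (M.Ultrafiber U) (M.ultrafiberTrace U)) =
        Cardinal.continuum) ∧
    (¬ HasDiffuseSummand (M.Ultrafiber U) →
      IsDirectSumOfMatrixAlgebras (M.Ultrafiber U) ∧
      TopologicalSpace.SeparableSpace
        (TracialState.L2 (M.Ultrafiber U) (M.ultrafiberTrace U))) :=
  ⟨M.densityCharacter_eq_continuum U hU,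
    (M.isCompleteTracial U hU).isDirectSumOfMatrixAlgebras⟩
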